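/- Let $H$ be a semisimple Hopf algebra over an algebraically closed field $k$ of characteristic $0$, with comultiplication $\Delta(h)=\sum h_1\otimes h_2$, counit $\varepsilon$ and antipode $S$, and let $\Lambda$ be its idempotent integral, i.e. the nonzero idempotent with $h\Lambda=\Lambda h=\varepsilon(h)\Lambda$ for all $h\in H$. Let $V_0,\dots,V_{n-1}$ be a complete set of pairwise non-isomorphic irreducible $H$-modules, with $V_0$ the trivial module ($h\cdot v=\varepsilon(h)v$), let $\chi_i$ be the character of $V_i$, let $d_i=\dim_k V_i$, and let $E_i$ be the central primitive idempotent of $H$ acting as the identity on $V_i$. For $p\in H^*$ put $s(p)=p\circ S$, let products in $H^*$ be convolution products, and let $A$ be the $n\times n$ matrix over $k$ with entries $$A_{ij}=\frac{\langle\chi_i\,s(\chi_i)\,s(\chi_j),\Lambda\rangle}{d_j},\qquad 0\le i,j\le n-1 .$$ For $a,b\in H$ put $\{a,b\}=\sum a_1b_1S(a_2)S(b_2)$, and define $\gamma_0=\Lambda$ and $\gamma_m=\{\gamma_{m-1},\Lambda\}$ for $m\ge 1$. Then for every $m\ge 1$ $$\gamma_m=\sum_{i=0}^{n-1}(A^m)_{i0}\,\frac{E_i}{d_i^2}=\sum_{i=0}^{n-1}\Bigl(\sum_{j=0}^{n-1}(A^{m-1})_{ij}\Bigr)\frac{E_i}{d_i^2}.$$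 Moreover, the coefficient of each $E_i$ in $\gamma_m$ is a nonzero rational number, and in particular $\gamma_m$ is invertible in $H$. -/

import Mathlib

open scoped TensorProduct

noncomputable section

namespace CommutatorMatrix

universe u v w

section Hopf

variable (k : Type u) {H : Type v} [Field k] [Ring H] [HopfAlgebra k H]

/-- The generalized commutator `{a, b} = ∑ a₁ b₁ S(a₂) S(b₂)`: send `Δ a ⊗ Δ b` to
`∑ (a₁ ⊗ b₁) ⊗ (a₂ ⊗ b₂)` and apply `(x ⊗ y) ⊗ (z ⊗ t) ↦ (x y) (S z S t)`. -/
def hopfCommutator (a b : H) : H :=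
  LinearMap.mul' k H
    (TensorProduct.map (LinearMap.mul' k H)
      (LinearMap.mul' k H ∘ₗ TensorProduct.map (HopfAlgebra.antipode k) (HopfAlgebra.antipode k))
      (TensorProduct.tensorTensorTensorComm k H H H H
        (Coalgebra.comul (R := k) a ⊗ₜ[k] Coalgebra.comul (R := k) b)))

/-- The commutator in Sweedler form. -/
theorem hopfCommutator_eq_sum {ι κ : Type*} {a b : H} (ra : Coalgebra.Repr k a ι)
    (rb : Coalgebra.Repr k b κ) :
    hopfCommutator k a b = ∑ i ∈ ra.index, ∑ j ∈ rb.index,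
      ra.left i * rb.left j * HopfAlgebra.antipode k (ra.right i)
        * HopfAlgebra.antipode k (rb.right j) := by
  unfold hopfCommutator
  rw [← ra.eq, ← rb.eq]
  simp [TensorProduct.sum_tmul, TensorProduct.tmul_sum, map_sum, mul_assoc]
  exact Finset.sum_comm

/-- `L` is an idempotent integral: a nonzero two-sided integral with `L² = L`. -/
structure IsIdempotentIntegral (L : H) : Prop where
  left : ∀ h : H, h * L = Coalgebra.counit (R := k) h • L
  right : ∀ h : H, L * h = Coalgebra.counit (R := k) h • L
  ne_zero : L ≠ 0
  idem : IsIdempotentElem L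

/-- The iterated commutators `γ₀ = L`, `γ_{m+1} = {γ_m, L}`. -/
def iteratedCommutator (L : H) : ℕ → H
  | 0 => L
  | m + 1 => hopfCommutator k (iteratedCommutator L m) L

/-- The antipode `s` of the dual: `s(p) = p ∘ S`. -/
def dualAntipode (p : H →ₗ[k] k) : H →ₗ[k] k :=
  p ∘ₗ HopfAlgebra.antipode k

variable (H) in
/-- The character of an `H`-module `V`: `h ↦ Tr (v ↦ h • v)`. -/
def character (V : Type w) [AddCommGroup V] [Module k V] [Module H V] [IsScalarTower k H V] :
    H →ₗ[k] k :=
  LinearMap.trace k V ∘ₗ (Algebra.lsmul k k V : H →ₐ[k] Module.End k V).toLinearMap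

end Hopf

/-- `e` is a primitive idempotent of the center of the ring `R`. -/
structure IsCentralPrimitiveIdempotent {R : Type v} [Ring R] (e : R) : Prop where
  mem_center : e ∈ Subring.center R
  idem : IsIdempotentElem e
  ne_zero : e ≠ 0
  primitive : ∀ f ∈ Subring.center R, IsIdempotentElem f → f * e = f → f = 0 ∨ f = e

/-- `V` is a complete list of pairwise non-isomorphic simple left `R`-modules. Every simple
`R`-module is a quotient of `R`, so it suffices to test modules in the universe of `R`. -/
structure IsCompleteSimpleFamily (R : Type v) [Ring R] {ι : Type*} (V : ι → Type w)
    [∀ i, AddCommGroup (V i)] [∀ i, Module R (V i)] : Prop where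
  simple : ∀ i, IsSimpleModule R (V i)
  not_iso : ∀ i j, Nonempty (V i ≃ₗ[R] V j) → i = j
  complete : ∀ (W : Type v) [AddCommGroup W] [Module R W], IsSimpleModule R W →
    ∃ i, Nonempty (W ≃ₗ[R] V i)

/-- The commutator matrix `A i j = ⟨χ_i s(χ_i) s(χ_j), L⟩ / d_j`, where the product of linear
functionals is the convolution product and `d_j = dim V_j`. -/
def commutatorMatrix (k : Type u) {H : Type v} [Field k] [Ring H] [HopfAlgebra k H] (L : H)
    {n : ℕ} (V : Fin n → Type w) [∀ i, AddCommGroup (V i)] [∀ i, Module k (V i)]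
    [∀ i, Module H (V i)] [∀ i, IsScalarTower k H (V i)] : Matrix (Fin n) (Fin n) k :=
  Matrix.of fun i j =>
    (WithConv.toConv (character k H (V i)) *
      WithConv.toConv (dualAntipode k (character k H (V i))) *
      WithConv.toConv (dualAntipode k (character k H (V j)))).ofConv L
        / (Module.finrank k (V j) : k)

end CommutatorMatrix

end

/-! By Schur's lemma the average ∑ L₁ T S(L₂) of an endomorphism T of V_i is a scalar, and once S² =
1 is known this scalar is tr(T)/d_i. With T = S(a₂) it follows that {a, L} acts on V_i as d_i⁻¹ ∑
χ_i(S(a₂)) a₁ (`hopfCommutator_smul`). The same orthogonality gives E_j = d_j ∑ χ_j(S(L₂)) L₁.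
Combining the two, {E_j, L} = ∑_i A_ij (d_j²/d_i²) E_i, and since E_0 = L, iteration produces column
0 of A^m. Column 0 of A itself is constantly 1, whence the row-sum formula. The numerator of A_ij is
the trace of the idempotent L on V_i ⊗ V_i* ⊗ V_j*, a natural number; so A is nonnegative and
rational, and column 0 of each positive power is positive.

Most of the work is S² = 1. The twist u = ∑ S(L₂) L₁ satisfies u h = S²(h) u and χ_j(u) = d_j, and
it is invertible. The form φ(a) = ∑ d_j χ_j(u⁻¹ a) has L₁ and S(L₂) as dual systems. This makes φ an
integral of H* and yields a group-like g with S⁴(a) g = g a (Radford). If φ(1) = tr S² is nonzero,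
then g = 1, S⁴ = 1, and integrality of traces of commuting idempotents forces S² = 1
(Larson–Radford).

For φ(1) ≠ 0: u² and g both implement S⁴ and g has finite order, so some power of u is central.
Hence u acts on V_j as a scalar times an operator of finite order, and φ(1) = ∑ χ_j(u) χ_j(u⁻¹) is a
sum of terms Q_j(ζ) Q_j(ζ⁻¹). Transported to ℂ these are squared absolute values; if the sum
vanished, so would every χ_j(u) = d_j. -/

noncomputable section

namespace CommutatorMatrix

open Coalgebra HopfAlgebra

universe u v w

/-! ### Actions of the dual on a coalgebra -/

section Coalg

variable {k : Type u} {H : Type v} [Field k] [AddCommGroup H] [Module k H] [Coalgebra k H]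

/-- The operator `h ↦ ∑ f(h₂) h₁`. -/
def rightHit (f : H →ₗ[k] k) : H →ₗ[k] H :=
  (TensorProduct.rid k H).toLinearMap ∘ₗ f.lTensor H ∘ₗ comul

/-- The operator `h ↦ ∑ f(h₁) h₂`. -/
def leftHit (f : H →ₗ[k] k) : H →ₗ[k] H :=
  (TensorProduct.lid k H).toLinearMap ∘ₗ f.rTensor H ∘ₗ comul

theorem rightHit_repr {ι : Type*} (f : H →ₗ[k] k) {h : H} (r : Repr k h ι) :
    rightHit f h = ∑ i ∈ r.index, f (r.right i) • r.left i := by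
  simp [rightHit, ← r.eq]

theorem leftHit_repr {ι : Type*} (f : H →ₗ[k] k) {h : H} (r : Repr k h ι) :
    leftHit f h = ∑ i ∈ r.index, f (r.left i) • r.right i := by
  simp [leftHit, ← r.eq]

theorem apply_rightHit (f g : H →ₗ[k] k) (h : H) : f (rightHit g h) = g (leftHit f h) := by
  rw [rightHit_repr g (ℛ k h), leftHit_repr f (ℛ k h)]
  simp [mul_comm]

theorem comul_leftHit (f : H →ₗ[k] k) (h : H) :
    comul (R := k) (leftHit f h) = (leftHit f).rTensor H (comul (R := k) h) := by
  have key : ∀ t : H ⊗[k] H, comul (R := k) ((TensorProduct.lid k H) (f.rTensor H t)) =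
      TensorProduct.lid k (H ⊗[k] H) (f.rTensor (H ⊗[k] H) ((comul (R := k)).lTensor H t)) := by
    intro t
    induction t using TensorProduct.induction_on with
    | zero => simp
    | tmul x y => simp
    | add x y hx hy => simp [map_add, hx, hy]
  have key2 : ∀ t : (H ⊗[k] H) ⊗[k] H,
      TensorProduct.lid k (H ⊗[k] H) (f.rTensor (H ⊗[k] H) (TensorProduct.assoc k H H H t)) =
      ((TensorProduct.lid k H).toLinearMap ∘ₗ f.rTensor H).rTensor H t := by
    intro t
    induction t using TensorProduct.induction_on with
    | zero => simp
    | tmul x y =>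
      induction x using TensorProduct.induction_on with
      | zero => simp
      | tmul x z => simp [TensorProduct.smul_tmul']
      | add x z hx hz => simp only [TensorProduct.add_tmul, map_add, hx, hz]
    | add x y hx hy => simp only [map_add, hx, hy]
  change comul (R := k) ((TensorProduct.lid k H) (f.rTensor H (comul (R := k) h))) = _
  rw [key, ← coassoc_apply, key2, ← LinearMap.comp_apply, ← LinearMap.rTensor_comp]
  rfl

theorem comul_rightHit (f : H →ₗ[k] k) (h : H) :
    comul (R := k) (rightHit f h) = (rightHit f).lTensor H (comul (R := k) h) := by
  have key : ∀ t : H ⊗[k] H, comul (R := k) ((TensorProduct.rid k H) (f.lTensor H t)) =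
      TensorProduct.rid k (H ⊗[k] H) (f.lTensor (H ⊗[k] H) ((comul (R := k)).rTensor H t)) := by
    intro t
    induction t using TensorProduct.induction_on with
    | zero => simp
    | tmul x y => simp
    | add x y hx hy => simp [map_add, hx, hy]
  have key2 : ∀ t : H ⊗[k] (H ⊗[k] H),
      TensorProduct.rid k (H ⊗[k] H)
        (f.lTensor (H ⊗[k] H) ((TensorProduct.assoc k H H H).symm t)) =
      ((TensorProduct.rid k H).toLinearMap ∘ₗ f.lTensor H).lTensor H t := by
    intro t
    induction t using TensorProduct.induction_on with
    | zero => simp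
    | tmul x y =>
      induction y using TensorProduct.induction_on with
      | zero => simp
      | tmul y z => simp
      | add y z hy hz => simp only [TensorProduct.tmul_add, map_add, hy, hz]
    | add x y hx hy => simp only [map_add, hx, hy]
  change comul (R := k) ((TensorProduct.rid k H) (f.lTensor H (comul (R := k) h))) = _
  rw [key, ← coassoc_symm_apply, key2, ← LinearMap.comp_apply, ← LinearMap.lTensor_comp]
  rfl

theorem leftHit_rightHit (f g : H →ₗ[k] k) (h : H) :
    leftHit f (rightHit g h) = rightHit g (leftHit f h) := by
  change TensorProduct.lid k H (f.rTensor H (comul (R := k) (rightHit g h))) = _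
  rw [comul_rightHit, leftHit_repr f (ℛ k h), ← (ℛ k h).eq]
  simp

theorem rightHit_rightHit (f g : H →ₗ[k] k) (h : H) :
    rightHit f (rightHit g h) = rightHit (f ∘ₗ rightHit g) h := by
  change TensorProduct.rid k H (f.lTensor H (comul (R := k) (rightHit g h))) = _
  rw [comul_rightHit, rightHit_repr _ (ℛ k h), ← (ℛ k h).eq]
  simp

theorem leftHit_leftHit (f g : H →ₗ[k] k) (h : H) :
    leftHit f (leftHit g h) = leftHit (f ∘ₗ leftHit g) h := by
  change TensorProduct.lid k H (f.rTensor H (comul (R := k) (leftHit g h))) = _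
  rw [comul_leftHit, leftHit_repr _ (ℛ k h), ← (ℛ k h).eq]
  simp

theorem counit_leftHit (f : H →ₗ[k] k) (h : H) : counit (R := k) (leftHit f h) = f h := by
  rw [← apply_rightHit]
  congr 1
  simp [rightHit]

theorem counit_rightHit (f : H →ₗ[k] k) (h : H) : counit (R := k) (rightHit f h) = f h := by
  rw [apply_rightHit]
  congr 1
  simp [leftHit]

end Coalg

/-! ### The Casimir element of an integral; finite-dimensionality -/

section Hopf

variable {k : Type u} {H : Type v} [Field k] [Ring H] [HopfAlgebra k H]

theorem lTensor_algebraMap_counit (h : H) :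
    (Algebra.linearMap k H ∘ₗ counit).lTensor H (comul (R := k) h) = h ⊗ₜ[k] (1 : H) := by
  rw [LinearMap.lTensor_comp, LinearMap.comp_apply, lTensor_counit_comul]
  simp

theorem sum_comul_mul_antipode {ι : Type*} {h : H} (r : Repr k h ι) :
    ∑ i ∈ r.index, comul (R := k) (r.left i) * ((1 : H) ⊗ₜ[k] antipode k (r.right i))
      = h ⊗ₜ[k] (1 : H) := by
  have key : ∀ (t : H ⊗[k] H) (y : H), t * ((1 : H) ⊗ₜ[k] antipode k y) =
      (LinearMap.mul' k H ∘ₗ (antipode k).lTensor H).lTensor H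
        (TensorProduct.assoc k H H H (t ⊗ₜ[k] y)) := by
    intro t y
    induction t using TensorProduct.induction_on with
    | zero => simp
    | tmul x y => simp
    | add x y hx hy => simp only [add_mul, TensorProduct.add_tmul, map_add, hx, hy]
  have h2 : ∑ i ∈ r.index, comul (R := k) (r.left i) ⊗ₜ[k] r.right i
      = (comul (R := k)).rTensor H (comul (R := k) h) := by
    rw [← r.eq]; simp
  simp only [key]
  rw [← map_sum, ← map_sum, h2, coassoc_apply, ← LinearMap.comp_apply, ← LinearMap.lTensor_comp,
    LinearMap.comp_assoc, mul_antipode_lTensor_comul, lTensor_algebraMap_counit]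

theorem sum_lTensor_antipode_comul_mul {ι : Type*} {h : H} (r : Repr k h ι) :
    ∑ i ∈ r.index, (antipode k).lTensor H (comul (R := k) (r.left i)) * ((1 : H) ⊗ₜ[k] r.right i)
      = h ⊗ₜ[k] (1 : H) := by
  have key : ∀ (t : H ⊗[k] H) (y : H), (antipode k).lTensor H t * ((1 : H) ⊗ₜ[k] y) =
      (LinearMap.mul' k H ∘ₗ (antipode k).rTensor H).lTensor H
        (TensorProduct.assoc k H H H (t ⊗ₜ[k] y)) := by
    intro t y
    induction t using TensorProduct.induction_on with
    | zero => simp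
    | tmul x y => simp
    | add x y hx hy => simp only [add_mul, TensorProduct.add_tmul, map_add, hx, hy]
  have h2 : ∑ i ∈ r.index, comul (R := k) (r.left i) ⊗ₜ[k] r.right i
      = (comul (R := k)).rTensor H (comul (R := k) h) := by
    rw [← r.eq]; simp
  simp only [key]
  rw [← map_sum, ← map_sum, h2, coassoc_apply, ← LinearMap.comp_apply, ← LinearMap.lTensor_comp,
    LinearMap.comp_assoc, mul_antipode_rTensor_comul, lTensor_algebraMap_counit]

/-- The element `∑ L₁ ⊗ S(L₂)`. -/
def casimir (k : Type u) {H : Type v} [Field k] [Ring H] [HopfAlgebra k H] (L : H) : H ⊗[k] H :=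
  (antipode k).lTensor H (comul (R := k) L)

variable {L : H}

/-- Write h ⊗ 1 = ∑ Δ(h₁)(1 ⊗ S(h₂)); the integral property turns Δ(L)Δ(h₁) = Δ(L h₁) into
ε(h₁)Δ(L). -/
theorem IsIdempotentIntegral.comul_mul_tmul_one (hL : IsIdempotentIntegral k L) (h : H) :
    comul (R := k) L * (h ⊗ₜ[k] 1) = comul (R := k) L * (1 ⊗ₜ[k] antipode k h) := by
  rw [← sum_comul_mul_antipode (ℛ k h), Finset.mul_sum]
  simp only [← mul_assoc, ← Bialgebra.comul_mul, hL.right, map_smul, smul_mul_assoc]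
  simp only [← mul_smul_comm, ← Finset.mul_sum, ← TensorProduct.tmul_smul, ← map_smul,
    ← TensorProduct.tmul_sum, ← map_sum, sum_counit_smul]

theorem IsIdempotentIntegral.tmul_one_mul_casimir (hL : IsIdempotentIntegral k L) (h : H) :
    (h ⊗ₜ[k] 1) * casimir k L = casimir k L * (1 ⊗ₜ[k] h) := by
  have gen : ∀ t : H ⊗[k] H, (h ⊗ₜ[k] 1) * (antipode k).lTensor H t =
      ∑ i ∈ (ℛ k h).index, (antipode k).lTensor H (comul (R := k) ((ℛ k h).left i) * t) *
        ((1 : H) ⊗ₜ[k] (ℛ k h).right i) := by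
    intro t
    induction t using TensorProduct.induction_on with
    | zero => simp
    | tmul p q =>
      have key : ∀ (s : H ⊗[k] H) (y : H),
          (antipode k).lTensor H (s * p ⊗ₜ[k] q) * ((1 : H) ⊗ₜ[k] y) =
          (1 ⊗ₜ[k] antipode k q) * ((antipode k).lTensor H s * (1 ⊗ₜ[k] y)) * (p ⊗ₜ[k] 1) := by
        intro s y
        induction s using TensorProduct.induction_on with
        | zero => simp
        | tmul a b => simp [antipode_mul_antidistrib, mul_assoc]
        | add a b ha hb => simp only [add_mul, mul_add, map_add, ha, hb]
      simp only [key]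
      rw [← Finset.sum_mul, ← Finset.mul_sum, sum_lTensor_antipode_comul_mul]
      simp
    | add x y hx hy => simp only [map_add, mul_add, hx, hy, add_mul, Finset.sum_add_distrib]
  rw [casimir, gen]
  simp only [← Bialgebra.comul_mul, hL.left, map_smul, smul_mul_assoc]
  simp only [← mul_smul_comm, ← Finset.mul_sum, ← TensorProduct.tmul_smul,
    ← TensorProduct.tmul_sum, sum_counit_smul]

theorem IsIdempotentIntegral.casimir_mul_tmul_one (hL : IsIdempotentIntegral k L) (h : H) :
    casimir k L * (h ⊗ₜ[k] 1) = (1 ⊗ₜ[k] antipode k (antipode k h)) * casimir k L := by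
  have e1 : ∀ t : H ⊗[k] H, (antipode k).lTensor H t * (h ⊗ₜ[k] 1) =
      (antipode k).lTensor H (t * (h ⊗ₜ[k] 1)) := by
    intro t
    induction t using TensorProduct.induction_on with
    | zero => simp
    | tmul a b => simp
    | add a b ha hb => simp only [add_mul, map_add, ha, hb]
  have e2 : ∀ (t : H ⊗[k] H) (y : H), (1 ⊗ₜ[k] antipode k y) * (antipode k).lTensor H t =
      (antipode k).lTensor H (t * (1 ⊗ₜ[k] y)) := by
    intro t y
    induction t using TensorProduct.induction_on with
    | zero => simp
    | tmul a b => simp [antipode_mul_antidistrib]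
    | add a b ha hb => simp only [add_mul, mul_add, map_add, ha, hb]
  rw [casimir, e1, e2, hL.comul_mul_tmul_one]

theorem IsIdempotentIntegral.counit_eq_one (hL : IsIdempotentIntegral k L) :
    counit (R := k) L = 1 := by
  have h : L = counit (R := k) L • L := by rw [← hL.left]; exact hL.idem.symm
  by_contra hne
  have : (1 - counit (R := k) L) • L = 0 := by rw [sub_smul, ← h, one_smul, sub_self]
  rcases smul_eq_zero.1 this with h' | h'
  · exact hne (sub_eq_zero.1 h').symm
  · exact hL.ne_zero h'

theorem IsIdempotentIntegral.rightHit_mul (hL : IsIdempotentIntegral k L) (f : H →ₗ[k] k) (h : H) :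
    rightHit f L * h = rightHit (f ∘ₗ LinearMap.mulRight k (antipode k h)) L := by
  have e1 : ∀ (t : H ⊗[k] H), TensorProduct.rid k H (f.lTensor H t) * h =
      TensorProduct.rid k H (f.lTensor H (t * (h ⊗ₜ[k] 1))) := by
    intro t
    induction t using TensorProduct.induction_on with
    | zero => simp
    | tmul a b => simp
    | add a b ha hb => simp only [add_mul, map_add, ha, hb]
  have e2 : ∀ (t : H ⊗[k] H) (y : H),
      TensorProduct.rid k H ((f ∘ₗ LinearMap.mulRight k y).lTensor H t) =
      TensorProduct.rid k H (f.lTensor H (t * (1 ⊗ₜ[k] y))) := by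
    intro t y
    induction t using TensorProduct.induction_on with
    | zero => simp
    | tmul a b => simp
    | add a b ha hb => simp only [add_mul, map_add, ha, hb]
  exact (e1 _).trans ((congrArg _ (congrArg _ (hL.comul_mul_tmul_one h))).trans (e2 _ _).symm)

/-- A Hopf algebra with an idempotent integral is finite-dimensional. -/
theorem IsIdempotentIntegral.finite (hL : IsIdempotentIntegral k L) : Module.Finite k H := by
  classical
  -- W is a right ideal inside a finite-dimensional span. It contains 1 = ∑ L₁ S(L₂), because the
  -- first legs of Δ(L) relative to a basis for the second legs lie in W. Hence W = H.
  let W : Submodule k H :=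
    { carrier := {x | ∃ f : H →ₗ[k] k, rightHit f L = x}
      add_mem' := by
        rintro _ _ ⟨f, rfl⟩ ⟨g, rfl⟩
        exact ⟨f + g, by simp [rightHit, LinearMap.lTensor_add]⟩
      zero_mem' := ⟨0, by simp [rightHit]⟩
      smul_mem' := by
        rintro c _ ⟨f, rfl⟩
        exact ⟨c • f, by simp [rightHit, LinearMap.lTensor_smul]⟩ }
  have hWle : W ≤ Submodule.span k (((ℛ k L).index.image (ℛ k L).left : Finset H) : Set H) := by
    rintro _ ⟨f, rfl⟩
    rw [rightHit_repr f (ℛ k L)]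
    exact Submodule.sum_mem _ fun i hi => Submodule.smul_mem _ _
      (Submodule.subset_span (Finset.mem_coe.2 (Finset.mem_image_of_mem _ hi)))
  have hWmul : ∀ x ∈ W, ∀ h : H, x * h ∈ W := by
    rintro _ ⟨f, rfl⟩ h
    exact ⟨_, (hL.rightHit_mul f h).symm⟩
  have hone : (1 : H) ∈ W := by
    let b := Module.Basis.ofVectorSpace k H
    obtain ⟨c, hc⟩ := TensorProduct.eq_repr_basis_right b (comul (R := k) L)
    have hmem : ∀ i, c i ∈ W := by
      intro i
      refine ⟨b.coord i, ?_⟩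
      change TensorProduct.rid k H ((b.coord i).lTensor H (comul (R := k) L)) = _
      rw [← hc, Finsupp.sum, map_sum, map_sum]
      simp only [LinearMap.lTensor_tmul, TensorProduct.rid_tmul, Module.Basis.coord_apply,
        Module.Basis.repr_self]
      simp +contextual [Finsupp.single_apply, eq_comm]
    have h1 := mul_antipode_lTensor_comul_apply (R := k) L
    rw [hL.counit_eq_one, map_one, ← hc, Finsupp.sum, map_sum, map_sum] at h1
    rw [← h1]
    refine Submodule.sum_mem _ fun i _ => ?_
    simpa using hWmul _ (hmem i) _
  have htop : W = ⊤ := by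
    rw [eq_top_iff]
    intro h _
    simpa using hWmul 1 hone h
  rw [htop] at hWle
  exact ⟨⟨_, top_le_iff.1 hWle⟩⟩

end Hopf

/-! ### The antipode reverses the comultiplication -/

section AntipodeComul

variable {k : Type u} {H : Type v} [Field k] [Ring H] [HopfAlgebra k H]

/-- The map `h ↦ ∑ S(h₂) ⊗ S(h₁)`. -/
def flipAntipodeComul (k : Type u) (H : Type v) [Field k] [Ring H] [HopfAlgebra k H] :
    H →ₗ[k] H ⊗[k] H :=
  (TensorProduct.comm k H H).toLinearMap ∘ₗ
    TensorProduct.map (antipode k) (antipode k) ∘ₗ comul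

theorem sum_one_tmul_mul_flipAntipodeComul {ι : Type*} {y : H} (r : Repr k y ι) :
    ∑ i ∈ r.index, ((1 : H) ⊗ₜ[k] r.left i) * flipAntipodeComul k H (r.right i)
      = antipode k y ⊗ₜ[k] (1 : H) := by
  have key : ∀ (a : H) (s : H ⊗[k] H), ((1 : H) ⊗ₜ[k] a) *
      TensorProduct.comm k H H (TensorProduct.map (antipode k) (antipode k) s) =
      TensorProduct.comm k H H (TensorProduct.map (LinearMap.mul' k H ∘ₗ (antipode k).lTensor H)
        (antipode k) ((TensorProduct.assoc k H H H).symm (a ⊗ₜ[k] s))) := by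
    intro a s
    induction s using TensorProduct.induction_on with
    | zero => simp
    | tmul x y => simp
    | add x y hx hy => simp only [mul_add, TensorProduct.tmul_add, map_add, hx, hy]
  have h2 : ∑ i ∈ r.index, r.left i ⊗ₜ[k] comul (R := k) (r.right i)
      = (comul (R := k)).lTensor H (comul (R := k) y) := by
    rw [← r.eq]; simp
  have h3 : TensorProduct.map (LinearMap.mul' k H ∘ₗ (antipode k).lTensor H)
        (antipode k) ((comul (R := k)).rTensor H (comul (R := k) y)) =
        (1 : H) ⊗ₜ[k] antipode k y := by
    rw [← LinearMap.comp_apply, LinearMap.map_comp_rTensor, LinearMap.comp_assoc,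
      mul_antipode_lTensor_comul, ← LinearMap.map_comp_rTensor, LinearMap.comp_apply,
      rTensor_counit_comul]
    simp
  simp only [flipAntipodeComul, LinearMap.comp_apply, LinearEquiv.coe_coe, key]
  rw [← map_sum, ← map_sum, ← map_sum, h2, coassoc_symm_apply, h3]
  simp

theorem sum_comul_mul_flipAntipodeComul (h : H) :
    LinearMap.mul' k (H ⊗[k] H) (TensorProduct.map comul (flipAntipodeComul k H)
      (comul (R := k) h)) = algebraMap k (H ⊗[k] H) (counit (R := k) h) := by
  let Ω : H ⊗[k] (H ⊗[k] H) →ₗ[k] H ⊗[k] H :=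
    LinearMap.mul' k (H ⊗[k] H) ∘ₗ TensorProduct.map .id (flipAntipodeComul k H) ∘ₗ
      (TensorProduct.assoc k H H H).symm.toLinearMap
  have h1 : ∀ t : H ⊗[k] H, LinearMap.mul' k (H ⊗[k] H)
      (TensorProduct.map comul (flipAntipodeComul k H) t) =
      Ω (TensorProduct.assoc k H H H ((comul (R := k)).rTensor H t)) := by
    intro t
    induction t using TensorProduct.induction_on with
    | zero => simp
    | tmul x y => simp [Ω]
    | add x y hx hy => simp only [map_add, hx, hy]
  have h2 : ∀ (x : H) (t : H ⊗[k] H), Ω (x ⊗ₜ[k] t) = (x ⊗ₜ[k] 1) *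
      Ω ((1 : H) ⊗ₜ[k] t) := by
    intro x t
    induction t using TensorProduct.induction_on with
    | zero => simp
    | tmul x y => simp [Ω, ← mul_assoc]
    | add x y hx hy => simp only [TensorProduct.tmul_add, map_add, hx, hy, mul_add]
  have h3 : ∀ y : H, Ω ((1 : H) ⊗ₜ[k] comul (R := k) y) = antipode k y ⊗ₜ[k] (1 : H) := by
    intro y
    rw [← sum_one_tmul_mul_flipAntipodeComul (ℛ k y), ← (ℛ k y).eq]
    simp [Ω, TensorProduct.tmul_sum]
  have h4 : ∀ x y : H, Ω (x ⊗ₜ[k] comul (R := k) y) = (x * antipode k y) ⊗ₜ[k] (1 : H) := by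
    intro x y
    rw [h2, h3, Algebra.TensorProduct.tmul_mul_tmul, mul_one]
  rw [h1, coassoc_apply, ← (ℛ k h).eq]
  simp only [map_sum, LinearMap.lTensor_tmul, h4, ← TensorProduct.sum_tmul]
  rw [sum_mul_antipode_eq_algebraMap_counit]
  rfl

/-- The two sides are a left and a right convolution inverse of Δ in Hom(H, H ⊗ H), hence equal. -/
theorem comul_antipode (h : H) :
    comul (R := k) (antipode k h) = flipAntipodeComul k H h := by
  have hl : WithConv.toConv ((comul (R := k) (A := H)) ∘ₗ antipode k) *
      WithConv.toConv (comul (R := k) (A := H)) = 1 := by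
    have := LinearMap.algHom_comp_convMul_distrib (R := k) (C := H)
      (Bialgebra.comulAlgHom k H) (WithConv.toConv (antipode k)) (WithConv.toConv .id)
    rw [LinearMap.antipode_mul_id] at this
    apply WithConv.ext
    refine this.symm.trans ?_
    ext x
    simp
  have hr : WithConv.toConv (comul (R := k) (A := H)) *
      WithConv.toConv (flipAntipodeComul k H) = 1 := by
    ext x
    exact sum_comul_mul_flipAntipodeComul x
  have := left_inv_eq_right_inv hl hr
  exact congrArg (fun f => f.ofConv h) this

theorem leftHit_antipode_antipode (f : H →ₗ[k] k) (h : H) :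
    leftHit f (antipode k (antipode k h)) =
      antipode k (antipode k (leftHit (f ∘ₗ antipode k ∘ₗ antipode k) h)) := by
  change TensorProduct.lid k H (f.rTensor H (comul (R := k) _)) = _
  rw [comul_antipode, flipAntipodeComul, LinearMap.comp_apply, LinearMap.comp_apply,
    comul_antipode, flipAntipodeComul, LinearMap.comp_apply, LinearMap.comp_apply,
    leftHit_repr _ (ℛ k h), ← (ℛ k h).eq]
  simp

end AntipodeComul

/-! ### The regular character -/

section TraceChar

variable {k : Type u} {H : Type v} [Field k] [Ring H] [HopfAlgebra k H] [Module.Finite k H]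

/-- The character of the left regular module. -/
def regularCharacter (k : Type u) (H : Type v) [Field k] [Ring H] [HopfAlgebra k H] :
    H →ₗ[k] k :=
  LinearMap.trace k H ∘ₗ LinearMap.mul k H

/-- The bijection x ⊗ y ↦ x₁ ⊗ x₂ y intertwines h ⊗ 1 with Δ(h), so Δ(h) has the trace of dim H
copies of the regular module. Consequently `leftHit` of the regular character is dim H times an
idempotent. -/
theorem regularCharacter_leftHit (h : H) :
    regularCharacter k H (leftHit (regularCharacter k H) h) =
      (Module.finrank k H : k) * regularCharacter k H h := by
  let φ : Module.End k (H ⊗[k] H) := (LinearMap.mul' k H).lTensor H ∘ₗ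
    (TensorProduct.assoc k H H H).toLinearMap ∘ₗ (comul (R := k)).rTensor H
  let ψ : Module.End k (H ⊗[k] H) := (LinearMap.mul' k H).lTensor H ∘ₗ
    ((antipode k).rTensor H).lTensor H ∘ₗ
    (TensorProduct.assoc k H H H).toLinearMap ∘ₗ (comul (R := k)).rTensor H
  have hφ : ∀ x y : H, φ (x ⊗ₜ y) = comul (R := k) x * (1 ⊗ₜ y) := by
    intro x y
    have : ∀ t : H ⊗[k] H, (LinearMap.mul' k H).lTensor H (TensorProduct.assoc k H H H (t ⊗ₜ y)) =
        t * (1 ⊗ₜ y) := by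
      intro t
      induction t using TensorProduct.induction_on with
      | zero => simp
      | tmul x y => simp
      | add x y hx hy => simp only [TensorProduct.add_tmul, map_add, hx, hy, add_mul]
    exact this _
  have hφm : ∀ (y : H) (t : H ⊗[k] H), φ (t * (1 ⊗ₜ y)) = φ t * (1 ⊗ₜ y) := by
    intro y t
    induction t using TensorProduct.induction_on with
    | zero => simp
    | tmul a b => simp [hφ, mul_assoc]
    | add a b ha hb => simp only [map_add, ha, hb, add_mul]
  have hψ : ∀ x y : H, ψ (x ⊗ₜ y) = (antipode k).lTensor H (comul (R := k) x) * (1 ⊗ₜ y) := by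
    intro x y
    have : ∀ t : H ⊗[k] H, (LinearMap.mul' k H).lTensor H (((antipode k).rTensor H).lTensor H
        (TensorProduct.assoc k H H H (t ⊗ₜ y))) = (antipode k).lTensor H t * (1 ⊗ₜ y) := by
      intro t
      induction t using TensorProduct.induction_on with
      | zero => simp
      | tmul x y => simp
      | add x y hx hy => simp only [TensorProduct.add_tmul, map_add, hx, hy, add_mul]
    exact this _
  have hφψ : φ * ψ = 1 := by
    apply TensorProduct.ext'
    intro x y
    change φ (ψ (x ⊗ₜ y)) = x ⊗ₜ y
    rw [hψ, hφm, ← (ℛ k x).eq, map_sum, map_sum]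
    simp only [LinearMap.lTensor_tmul, hφ]
    rw [sum_comul_mul_antipode]
    simp
  have hψφ : ψ * φ = 1 := mul_eq_one_comm.1 hφψ
  have hint : LinearMap.mul k (H ⊗[k] H) (comul (R := k) h) * φ =
      φ * (LinearMap.mul k H h).rTensor H := by
    apply TensorProduct.ext'
    intro x y
    simp [hφ, mul_assoc]
  have htr : LinearMap.trace k (H ⊗[k] H) (LinearMap.mul k (H ⊗[k] H) (comul (R := k) h)) =
      LinearMap.trace k (H ⊗[k] H) ((LinearMap.mul k H h).rTensor H) := by
    rw [← mul_one (LinearMap.mul k (H ⊗[k] H) (comul (R := k) h)), ← hφψ, ← mul_assoc, hint,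
      mul_assoc, LinearMap.trace_mul_comm, mul_assoc, hψφ, mul_one]
  rw [LinearMap.rTensor, LinearMap.trace_tensorProduct', LinearMap.trace_id, mul_comm] at htr
  refine Eq.trans ?_ htr
  rw [leftHit_repr _ (ℛ k h), ← (ℛ k h).eq]
  simp only [map_sum, map_smul]
  refine Finset.sum_congr rfl fun i _ => ?_
  have : LinearMap.mul k (H ⊗[k] H) ((ℛ k h).left i ⊗ₜ (ℛ k h).right i) =
      TensorProduct.map (LinearMap.mul k H ((ℛ k h).left i))
        (LinearMap.mul k H ((ℛ k h).right i)) := by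
    apply TensorProduct.ext'
    intro x y
    simp
  rw [this, LinearMap.trace_tensorProduct']
  rfl

theorem regularCharacter_integral {L : H} (hL : IsIdempotentIntegral k L) :
    regularCharacter k H L = 1 := by
  have : LinearMap.mul k H L = (counit (R := k)).smulRight L := by
    ext h
    simp [hL.right]
  rw [regularCharacter, LinearMap.comp_apply, this, LinearMap.trace_smulRight, hL.counit_eq_one]

end TraceChar

/-! ### The twist element and the square of the antipode -/

section Twist

variable {k : Type u} {H : Type v} [Field k] [Ring H] [HopfAlgebra k H] {L : H}

theorem casimir_eq_sum (L : H) : casimir k L =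
    ∑ i ∈ (ℛ k L).index, (ℛ k L).left i ⊗ₜ[k] antipode k ((ℛ k L).right i) := by
  rw [casimir, ← (ℛ k L).eq]
  simp

theorem IsIdempotentIntegral.sum_apply_mul (hL : IsIdempotentIntegral k L)
    {M : Type*} [AddCommGroup M] [Module k M] (f : H →ₗ[k] H →ₗ[k] M) (h : H) :
    ∑ i ∈ (ℛ k L).index, f (h * (ℛ k L).left i) (antipode k ((ℛ k L).right i)) =
    ∑ i ∈ (ℛ k L).index, f ((ℛ k L).left i) (antipode k ((ℛ k L).right i) * h) := by
  simpa [casimir_eq_sum, Finset.mul_sum, Finset.sum_mul] using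
    congrArg (TensorProduct.lift f) (hL.tmul_one_mul_casimir h)

theorem IsIdempotentIntegral.sum_apply_mul' (hL : IsIdempotentIntegral k L)
    {M : Type*} [AddCommGroup M] [Module k M] (f : H →ₗ[k] H →ₗ[k] M) (h : H) :
    ∑ i ∈ (ℛ k L).index, f ((ℛ k L).left i * h) (antipode k ((ℛ k L).right i)) =
    ∑ i ∈ (ℛ k L).index, f ((ℛ k L).left i)
      (antipode k (antipode k h) * antipode k ((ℛ k L).right i)) := by
  simpa [casimir_eq_sum, Finset.mul_sum, Finset.sum_mul] using
    congrArg (TensorProduct.lift f) (hL.casimir_mul_tmul_one h)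

/-- The element `∑ S(L₂) L₁`, which implements the square of the antipode. -/
def twist (k : Type u) {H : Type v} [Field k] [Ring H] [HopfAlgebra k H] (L : H) : H :=
  ∑ i ∈ (ℛ k L).index, antipode k ((ℛ k L).right i) * (ℛ k L).left i

theorem IsIdempotentIntegral.twist_mul (hL : IsIdempotentIntegral k L) (h : H) :
    twist k L * h = antipode k (antipode k h) * twist k L := by
  simpa [twist, Finset.sum_mul, Finset.mul_sum, mul_assoc] using
    hL.sum_apply_mul' (LinearMap.mul k H).flip h

theorem IsIdempotentIntegral.sum_mul_antipode (hL : IsIdempotentIntegral k L) :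
    ∑ i ∈ (ℛ k L).index, (ℛ k L).left i * antipode k ((ℛ k L).right i) = 1 := by
  rw [sum_mul_antipode_eq_smul, hL.counit_eq_one, one_smul]

end Twist

/-! ### Averaging and Schur orthogonality -/

section Modules

variable {k : Type u} {H : Type v} [Field k] [Ring H] [HopfAlgebra k H] {L : H}
variable {V W : Type*} [AddCommGroup V] [Module k V] [Module H V] [IsScalarTower k H V]
  [AddCommGroup W] [Module k W] [Module H W] [IsScalarTower k H W]

/-- The action of an algebra on a module as a map to linear endomorphisms. -/
abbrev rho (k : Type*) {H : Type*} [Field k] [Ring H] [Algebra k H]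
    (V : Type*) [AddCommGroup V] [Module k V] [Module H V] [IsScalarTower k H V] :
    H →ₐ[k] Module.End k V :=
  Algebra.lsmul k k V

theorem character_apply (h : H) : character k H V h = LinearMap.trace k V (rho k V h) := rfl

theorem character_mul_comm (a b : H) :
    character k H V (a * b) = character k H V (b * a) := by
  rw [character_apply, character_apply, map_mul (rho k V), map_mul (rho k V),
    LinearMap.trace_mul_comm]

/-- The average `w ↦ ∑ L₁ T(S(L₂) w)` of a linear map, which is a module homomorphism. -/
def IsIdempotentIntegral.average (hL : IsIdempotentIntegral k L) (T : V →ₗ[k] W) : V →ₗ[H] W where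
  toFun w := ∑ i ∈ (ℛ k L).index, (ℛ k L).left i • T (antipode k ((ℛ k L).right i) • w)
  map_add' x y := by simp [Finset.sum_add_distrib]
  map_smul' h w := by
    have := hL.sum_apply_mul ((LinearMap.lcomp k W ((rho k V).toLinearMap.flip w)) ∘ₗ
      (LinearMap.lcomp k W T) ∘ₗ (rho k W).toLinearMap) h
    simpa [mul_smul, Finset.smul_sum] using this.symm

theorem IsIdempotentIntegral.average_apply (hL : IsIdempotentIntegral k L) (T : V →ₗ[k] W)
    (w : V) : hL.average T w =
      ∑ i ∈ (ℛ k L).index, (ℛ k L).left i • T (antipode k ((ℛ k L).right i) • w) := rfl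

/-- The left side is the average of a rank-one map, a homomorphism between non-isomorphic simple
modules. -/
theorem IsIdempotentIntegral.sum_smul_smul_of_not_iso (hL : IsIdempotentIntegral k L)
    [IsSimpleModule H V] [IsSimpleModule H W] (h : ¬ Nonempty (V ≃ₗ[H] W))
    (f : V →ₗ[k] k) (v : W) (w : V) :
    ∑ i ∈ (ℛ k L).index, f (antipode k ((ℛ k L).right i) • w) • (ℛ k L).left i • v = 0 := by
  have h0 : hL.average (f.smulRight v) = 0 := by
    rcases LinearMap.bijective_or_eq_zero (hL.average (f.smulRight v)) with hb | h0
    · exact absurd ⟨LinearEquiv.ofBijective _ hb⟩ h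
    · exact h0
  have := congrArg (fun T : V →ₗ[H] W => T w) h0
  simpa [hL.average_apply, smul_algebra_smul_comm] using this

theorem trace_eq_sum_repr {ι : Type*} [Fintype ι] (b : Module.Basis ι k V) (f : Module.End k V) :
    LinearMap.trace k V f = ∑ i, b.coord i (f (b i)) := by
  classical
  rw [LinearMap.trace_eq_matrix_trace k b, Matrix.trace]
  simp [LinearMap.toMatrix_apply]

variable [IsAlgClosed k] [CharZero k]

/-- Schur's lemma gives a scalar; its value comes from taking traces, where cyclicity turns L₁ T
S(L₂) into S(L₂) L₁ T. -/
theorem IsIdempotentIntegral.average_eq_smul (hL : IsIdempotentIntegral k L)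
    [IsSimpleModule H V] [Module.Finite k V] (T : V →ₗ[k] V) (w : V) :
    hL.average T w = (LinearMap.trace k V (rho k V (twist k L) * T) / Module.finrank k V) • w := by
  obtain ⟨t, ht⟩ := (IsSimpleModule.algebraMap_end_bijective_of_isAlgClosed (A := H) (V := V) k).2
    (hL.average T)
  have hnt : Nontrivial V := IsSimpleModule.nontrivial H V
  have hd : (Module.finrank k V : k) ≠ 0 := Nat.cast_ne_zero.2 Module.finrank_pos.ne'
  have h1 : ∀ w, hL.average T w = t • w := fun w => by rw [← ht]; rfl
  have h2 : (∑ i ∈ (ℛ k L).index, rho k V ((ℛ k L).left i) *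
      (T * rho k V (antipode k ((ℛ k L).right i)))) = t • (1 : Module.End k V) := by
    ext w
    simpa [hL.average_apply] using h1 w
  have h3 := congrArg (LinearMap.trace k V) h2
  have h4 : LinearMap.trace k V (rho k V (twist k L) * T) = t * Module.finrank k V := by
    rw [map_smul, LinearMap.trace_one, smul_eq_mul] at h3
    rw [← h3, twist]
    simp only [map_sum, map_mul, Finset.sum_mul]
    refine Finset.sum_congr rfl fun i _ => ?_
    rw [mul_assoc, LinearMap.trace_mul_comm, mul_assoc]
  rw [h1, h4, mul_div_cancel_right₀ _ hd]

theorem IsIdempotentIntegral.sum_smul_smul (hL : IsIdempotentIntegral k L)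
    [IsSimpleModule H V] [Module.Finite k V] (f : V →ₗ[k] k) (v w : V) :
    ∑ i ∈ (ℛ k L).index, f (antipode k ((ℛ k L).right i) • w) • (ℛ k L).left i • v =
      (f (twist k L • v) / Module.finrank k V) • w := by
  have h1 := hL.average_eq_smul (f.smulRight v) w
  have h2 : rho k V (twist k L) * f.smulRight v = f.smulRight (twist k L • v) := by
    ext x
    simp
  rw [h2, LinearMap.trace_smulRight] at h1
  rw [← h1]
  simp [hL.average_apply, smul_algebra_smul_comm]

/-- The average of the identity is ∑ L₁ S(L₂) = 1, so the Schur scalar for T = 1 is 1. -/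
theorem IsIdempotentIntegral.character_twist (hL : IsIdempotentIntegral k L)
    [IsSimpleModule H V] [Module.Finite k V] :
    character k H V (twist k L) = Module.finrank k V := by
  have hnt : Nontrivial V := IsSimpleModule.nontrivial H V
  have hd : (Module.finrank k V : k) ≠ 0 := Nat.cast_ne_zero.2 Module.finrank_pos.ne'
  obtain ⟨w, hw⟩ := exists_ne (0 : V)
  have h1 := hL.average_eq_smul (LinearMap.id : V →ₗ[k] V) w
  have h2 : hL.average (LinearMap.id : V →ₗ[k] V) w = w := by
    simp only [hL.average_apply, LinearMap.id_apply, ← mul_smul, ← Finset.sum_smul]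
    rw [hL.sum_mul_antipode, one_smul]
  rw [h2, ← Module.End.one_eq_id, mul_one, ← character_apply] at h1
  have h3 : (1 - character k H V (twist k L) / Module.finrank k V) • w = 0 := by
    rw [sub_smul, ← h1, one_smul, sub_self]
  rcases smul_eq_zero.1 h3 with h3 | h3
  · rw [sub_eq_zero, eq_comm, div_eq_one_iff_eq hd] at h3
    exact h3
  · exact absurd h3 hw

/-- The kernel of u is a submodule because u h = S²(h) u, and it is not everything because u has
trace d ≠ 0. -/
theorem IsIdempotentIntegral.eq_zero_of_twist_smul (hL : IsIdempotentIntegral k L)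
    [IsSimpleModule H V] [Module.Finite k V] {v : V} (hv : twist k L • v = 0) : v = 0 := by
  have hnt : Nontrivial V := IsSimpleModule.nontrivial H V
  have hd : (Module.finrank k V : k) ≠ 0 := Nat.cast_ne_zero.2 Module.finrank_pos.ne'
  let K : Submodule H V :=
    { carrier := {v | twist k L • v = 0}
      add_mem' := by
        intro a b ha hb
        simp only [Set.mem_ofPred_eq] at *
        rw [smul_add, ha, hb, add_zero]
      zero_mem' := smul_zero _
      smul_mem' := by
        intro h x hx
        simp only [Set.mem_ofPred_eq] at *
        rw [← mul_smul, hL.twist_mul, mul_smul, hx, smul_zero] }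
  rcases eq_bot_or_eq_top K with h | h
  · have : v ∈ K := hv
    rw [h] at this
    simpa using this
  · exfalso
    have h0 : rho k V (twist k L) = 0 := by
      ext x
      have : x ∈ K := h ▸ Submodule.mem_top
      exact this
    have := hL.character_twist (V := V)
    rw [character_apply, h0, map_zero] at this
    exact hd this.symm

end Modules

/-! ### Complete families of simple modules; the dual form -/

section Family

/-- A semisimple ring is the sum of its simple left ideals, each isomorphic to some V i; so x
annihilates 1. -/
theorem IsCompleteSimpleFamily.eq_zero_of_smul {R : Type v} [Ring R] [IsSemisimpleRing R]
    {ι : Type*} {V : ι → Type w} [∀ i, AddCommGroup (V i)] [∀ i, Module R (V i)]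
    (hV : IsCompleteSimpleFamily R V) {x : R} (hx : ∀ i (v : V i), x • v = 0) : x = 0 := by
  have h1 : (1 : R) ∈ sSup {N : Submodule R R | IsSimpleModule R N} := by
    rw [IsSemisimpleModule.sSup_simples_eq_top]; trivial
  rw [sSup_eq_iSup'] at h1
  have : ∀ y ∈ ⨆ N : {N : Submodule R R | IsSimpleModule R N}, (N : Submodule R R), x * y = 0 := by
    intro y hy
    induction hy using Submodule.iSup_induction' with
    | mem N y hy =>
      obtain ⟨N, hN⟩ := N
      obtain ⟨i, ⟨e⟩⟩ := hV.complete N hN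
      have h2 : x • (⟨y, hy⟩ : N) = 0 := by
        apply e.injective
        rw [map_smul, hx, map_zero]
      simpa using congrArg Subtype.val h2
    | zero => simp
    | add a b _ _ ha hb => rw [mul_add, ha, hb, add_zero]
  simpa using this 1 h1

theorem IsCompleteSimpleFamily.ext {R : Type v} [Ring R] [IsSemisimpleRing R]
    {ι : Type*} {V : ι → Type w} [∀ i, AddCommGroup (V i)] [∀ i, Module R (V i)]
    (hV : IsCompleteSimpleFamily R V) {x y : R} (hx : ∀ i (v : V i), x • v = y • v) : x = y :=
  sub_eq_zero.1 <| hV.eq_zero_of_smul fun i v => by rw [sub_smul, hx, sub_self]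

variable {k : Type u} {H : Type v} [Field k] [Ring H]
  [HopfAlgebra k H] {L : H} {n : ℕ} {V : Fin n → Type w}
  [∀ i, AddCommGroup (V i)] [∀ i, Module k (V i)]
  [∀ i, Module H (V i)] [∀ i, IsScalarTower k H (V i)]

theorem IsIdempotentIntegral.finite_simple (hL : IsIdempotentIntegral k L)
    (hV : IsCompleteSimpleFamily H V) (i : Fin n) : Module.Finite k (V i) := by
  have := hL.finite
  have := hV.simple i
  exact Module.Finite.trans H (V i)

/-- The functional `a ↦ ∑ d_j χ_j(t a)`. -/
def weightedCharacter (k : Type u) {H : Type v} [Field k] [Ring H] [HopfAlgebra k H]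
    {n : ℕ} (V : Fin n → Type w) [∀ i, AddCommGroup (V i)] [∀ i, Module k (V i)]
    [∀ i, Module H (V i)] [∀ i, IsScalarTower k H (V i)] (t : H) : H →ₗ[k] k :=
  ∑ j, (Module.finrank k (V j) : k) • (character k H (V j) ∘ₗ LinearMap.mulLeft k t)

theorem weightedCharacter_apply (t a : H) : weightedCharacter k V t a =
    ∑ j, (Module.finrank k (V j) : k) * character k H (V j) (t * a) := by
  simp [weightedCharacter]

theorem IsIdempotentIntegral.weightedCharacter_mul (hL : IsIdempotentIntegral k L)
    {t : H} (ht : t * twist k L = 1) (ht' : twist k L * t = 1) (a b : H) :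
    weightedCharacter k V t (a * b) =
      weightedCharacter k V t (antipode k (antipode k b) * a) := by
  simp only [weightedCharacter_apply]
  refine Finset.sum_congr rfl fun j _ => ?_
  have h1 : t * antipode k (antipode k b) = b * t := by
    calc t * antipode k (antipode k b) = t * (antipode k (antipode k b) * twist k L) * t := by
          rw [mul_assoc, mul_assoc, ht', mul_one]
      _ = b * t := by rw [← hL.twist_mul, ← mul_assoc, ht, one_mul]
  rw [← mul_assoc, ← mul_assoc, h1, character_mul_comm, ← mul_assoc]

variable [IsAlgClosed k] [CharZero k] [IsSemisimpleRing H]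


theorem IsIdempotentIntegral.isUnit_twist (hL : IsIdempotentIntegral k L)
    (hV : IsCompleteSimpleFamily H V) : IsUnit (twist k L) := by
  have := hL.finite
  have inj : ∀ x, twist k L * x = 0 → x = 0 := by
    intro x hx
    refine hV.eq_zero_of_smul fun i v => ?_
    have := hV.simple i
    have := hL.finite_simple hV i
    refine hL.eq_zero_of_twist_smul ?_
    rw [← mul_smul, hx, zero_smul]
  have hinj : Function.Injective (LinearMap.mulLeft k (twist k L)) := by
    rw [injective_iff_map_eq_zero]
    exact inj
  obtain ⟨y, hy⟩ := (LinearMap.injective_iff_surjective.1 hinj) 1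
  change twist k L * y = 1 at hy
  refine ⟨⟨twist k L, y, hy, ?_⟩, rfl⟩
  rw [← sub_eq_zero]
  apply inj
  rw [mul_sub, ← mul_assoc, hy, one_mul, mul_one, sub_self]

theorem IsIdempotentIntegral.antipode_injective (hL : IsIdempotentIntegral k L)
    (hV : IsCompleteSimpleFamily H V) : Function.Injective (antipode k (A := H)) := by
  rw [injective_iff_map_eq_zero]
  intro a ha
  obtain ⟨U, hU⟩ := hL.isUnit_twist hV
  have := hL.twist_mul a
  rw [ha, map_zero, zero_mul, ← hU] at this
  exact (Units.mul_right_eq_zero U).1 this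

/-- Tested on each V j after expanding the characters in bases: orthogonality leaves only the index
j, where the weight d_j and the factor t = u⁻¹ cancel the 1/d_j and the u of the Schur relation. -/
theorem IsIdempotentIntegral.sum_weightedCharacter_left (hL : IsIdempotentIntegral k L)
    (hV : IsCompleteSimpleFamily H V) {t : H} (ht : t * twist k L = 1) (a : H) :
    ∑ i ∈ (ℛ k L).index, weightedCharacter k V t (antipode k ((ℛ k L).right i) * a) •
      (ℛ k L).left i = a := by
  have := hL.finite_simple hV
  have := hV.simple
  refine hV.ext fun j v => ?_
  have hnt : Nontrivial (V j) := IsSimpleModule.nontrivial H (V j)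
  have hd : (Module.finrank k (V j) : k) ≠ 0 := Nat.cast_ne_zero.2 Module.finrank_pos.ne'
  have hl : ∀ l, ∑ i ∈ (ℛ k L).index,
      character k H (V l) (t * (antipode k ((ℛ k L).right i) * a)) • (ℛ k L).left i • v =
      ∑ b, ∑ i ∈ (ℛ k L).index, ((Module.finBasis k (V l)).coord b ∘ₗ rho k (V l) t)
        (antipode k ((ℛ k L).right i) • (a • Module.finBasis k (V l) b)) •
          (ℛ k L).left i • v := by
    intro l
    rw [Finset.sum_comm]
    refine Finset.sum_congr rfl fun i _ => ?_
    rw [character_apply, trace_eq_sum_repr (Module.finBasis k (V l)), Finset.sum_smul]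
    refine Finset.sum_congr rfl fun b _ => ?_
    simp
  rw [Finset.sum_smul]
  simp only [weightedCharacter_apply, Finset.sum_smul, smul_assoc, mul_smul]
  rw [Finset.sum_comm]
  simp only [← Finset.smul_sum, hl]
  rw [Finset.sum_eq_single j]
  · simp only [hL.sum_smul_smul]
    simp only [LinearMap.comp_apply, Algebra.lsmul_coe, ← mul_smul t, ht, one_smul]
    rw [Finset.smul_sum]
    simp only [← smul_assoc, smul_eq_mul, mul_div_cancel₀ _ hd]
    conv_rhs => rw [← (Module.finBasis k (V j)).sum_repr v, Finset.smul_sum]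
    refine Finset.sum_congr rfl fun b _ => ?_
    rw [Module.Basis.coord_apply, smul_algebra_smul_comm, smul_assoc]
  · intro l _ hlj
    simp only [hL.sum_smul_smul_of_not_iso (fun h => hlj (hV.not_iso l j h)),
      Finset.sum_const_zero, smul_zero]
  · simp

theorem IsIdempotentIntegral.sum_weightedCharacter_right (hL : IsIdempotentIntegral k L)
    (hV : IsCompleteSimpleFamily H V) {t : H} (ht : twist k L * t = 1) (a : H) :
    ∑ i ∈ (ℛ k L).index, weightedCharacter k V t (a * (ℛ k L).left i) •
      antipode k ((ℛ k L).right i) = a := by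
  have := hL.finite_simple hV
  have := hV.simple
  refine hV.ext fun j w => ?_
  have hnt : Nontrivial (V j) := IsSimpleModule.nontrivial H (V j)
  have hd : (Module.finrank k (V j) : k) ≠ 0 := Nat.cast_ne_zero.2 Module.finrank_pos.ne'
  refine (Module.finBasis k (V j)).ext_elem fun c => ?_
  rw [← Module.Basis.coord_apply, ← Module.Basis.coord_apply]
  generalize (Module.finBasis k (V j)).coord c = f
  have hl : ∀ l, ∑ i ∈ (ℛ k L).index,
      character k H (V l) (t * (a * (ℛ k L).left i)) * f (antipode k ((ℛ k L).right i) • w) =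
      ∑ b, ((Module.finBasis k (V l)).coord b ∘ₗ rho k (V l) (t * a))
        (∑ i ∈ (ℛ k L).index, f (antipode k ((ℛ k L).right i) • w) •
          (ℛ k L).left i • Module.finBasis k (V l) b) := by
    intro l
    simp only [map_sum, map_smul]
    rw [Finset.sum_comm]
    refine Finset.sum_congr rfl fun i _ => ?_
    rw [character_apply, trace_eq_sum_repr (Module.finBasis k (V l)), Finset.sum_mul]
    refine Finset.sum_congr rfl fun b _ => ?_
    simp [mul_comm]
  rw [Finset.sum_smul, map_sum]
  simp only [weightedCharacter_apply, Finset.sum_mul, smul_assoc, map_smul, smul_eq_mul, mul_assoc]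
  rw [Finset.sum_comm]
  simp only [← Finset.mul_sum, hl]
  rw [Finset.sum_eq_single j]
  · simp only [hL.sum_smul_smul, map_smul, smul_eq_mul, LinearMap.comp_apply]
    have hexp : f (a • w) = ∑ b, f (twist k L • Module.finBasis k (V j) b) *
        (Module.finBasis k (V j)).coord b (rho k (V j) (t * a) w) := by
      conv_lhs => rw [← one_smul H (a • w), ← ht, mul_smul, ← mul_smul t,
        ← (Module.finBasis k (V j)).sum_repr ((t * a) • w), Finset.smul_sum, map_sum]
      refine Finset.sum_congr rfl fun b _ => ?_
      rw [smul_algebra_smul_comm, map_smul, smul_eq_mul, mul_comm]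
      rfl
    rw [hexp, Finset.mul_sum]
    refine Finset.sum_congr rfl fun b _ => ?_
    field_simp
  · intro l _ hlj
    simp only [hL.sum_smul_smul_of_not_iso (fun h => hlj (hV.not_iso j l h).symm),
      map_zero, Finset.sum_const_zero, mul_zero]
  · simp

end Family

/-! ### Frobenius form, Radford's formula and the Larson–Radford argument -/

section Frobenius

variable {k : Type u} {H : Type v} [Field k] [Ring H] [HopfAlgebra k H] {L : H}

/-- A linear form whose dual bases are given by the integral `L`. -/
structure IsDualForm (L : H) (φ : H →ₗ[k] k) : Prop where
  left : ∀ a : H, ∑ i ∈ (ℛ k L).index, φ (antipode k ((ℛ k L).right i) * a) • (ℛ k L).left i = a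
  right : ∀ a : H, ∑ i ∈ (ℛ k L).index, φ (a * (ℛ k L).left i) • antipode k ((ℛ k L).right i) = a
  nakayama : ∀ a b : H, φ (a * b) = φ (antipode k (antipode k b) * a)
  antipode_injective : Function.Injective (antipode k (A := H))

theorem rightHit_one (f : H →ₗ[k] k) : rightHit f 1 = f 1 • (1 : H) := by
  simp [rightHit, Algebra.TensorProduct.one_def]

namespace IsDualForm

variable {φ : H →ₗ[k] k}

theorem exists_rightHit (h : IsDualForm L φ) (x : H) : ∃ p : H →ₗ[k] k, rightHit p L = x :=
  ⟨φ ∘ₗ LinearMap.mulRight k x ∘ₗ antipode k, by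
    rw [rightHit_repr _ (ℛ k L)]
    exact h.left x⟩

theorem exists_leftHit (h : IsDualForm L φ) (x : H) : ∃ p : H →ₗ[k] k, leftHit p L = x :=
  ⟨φ ∘ₗ LinearMap.mulLeft k (antipode k x), h.antipode_injective <| by
    rw [leftHit_repr _ (ℛ k L), map_sum]
    simpa using h.right (antipode k x)⟩

theorem leftHit_integral (h : IsDualForm L φ) : leftHit φ L = 1 := by
  apply h.antipode_injective
  rw [leftHit_repr _ (ℛ k L), map_sum]
  simpa using h.right 1

theorem rightHit_antipode_integral (h : IsDualForm L φ) : rightHit (φ ∘ₗ antipode k) L = 1 := by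
  rw [rightHit_repr _ (ℛ k L)]
  simpa using h.left 1

theorem apply_integral (h : IsDualForm L φ) : φ L = 1 := by
  rw [← counit_leftHit, h.leftHit_integral, Bialgebra.counit_one]

/-- The form is an integral of the dual: every x is some `rightHit p L`, the two hit actions
commute, and the claim reduces to `leftHit φ L = 1`. -/
theorem leftHit_eq (h : IsDualForm L φ) (x : H) : leftHit φ x = φ x • (1 : H) := by
  obtain ⟨p, rfl⟩ := h.exists_rightHit x
  rw [leftHit_rightHit, apply_rightHit, h.leftHit_integral, rightHit_one]

theorem rightHit_eq (h : IsDualForm L φ) (x : H) : rightHit φ x = φ x • rightHit φ L := by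
  obtain ⟨p, rfl⟩ := h.exists_rightHit x
  have : φ ∘ₗ rightHit p = p 1 • φ := by
    ext y
    simp [apply_rightHit, h.leftHit_eq, mul_comm]
  rw [rightHit_rightHit, this, apply_rightHit, h.leftHit_integral]
  simp [rightHit, LinearMap.lTensor_smul]

theorem isGroupLikeElem (h : IsDualForm L φ) : IsGroupLikeElem k (rightHit φ L) where
  counit_eq_one := by rw [counit_rightHit, h.apply_integral]
  comul_eq_tmul_self := by
    have key : ∀ t : H ⊗[k] H, (rightHit φ).lTensor H t =
        TensorProduct.rid k H (φ.lTensor H t) ⊗ₜ[k] rightHit φ L := by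
      intro t
      induction t using TensorProduct.induction_on with
      | zero => simp
      | tmul a b =>
        rw [LinearMap.lTensor_tmul, h.rightHit_eq]
        simp [TensorProduct.smul_tmul]
      | add a b ha hb => simp only [map_add, ha, hb, TensorProduct.add_tmul]
    rw [comul_rightHit, key]
    rfl

/-- Both x ↦ φ(S x) and x ↦ φ(g x) send L to 1 under `rightHit`; by adjointness they agree on every
`leftHit q L`, that is, everywhere. -/
theorem apply_antipode (h : IsDualForm L φ) (hL : IsIdempotentIntegral k L) (x : H) :
    φ (antipode k x) = φ (rightHit φ L * x) := by
  have hg := h.isGroupLikeElem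
  set g := rightHit φ L with hgdef
  have hμ : ∀ y, rightHit (φ ∘ₗ LinearMap.mulLeft k g) y = φ (g * y) • (1 : H) := by
    intro y
    have h1 : rightHit φ (g * y) = g * rightHit (φ ∘ₗ LinearMap.mulLeft k g) y := by
      have : ∀ t : H ⊗[k] H, TensorProduct.rid k H (φ.lTensor H ((g ⊗ₜ g) * t)) =
          g * TensorProduct.rid k H ((φ ∘ₗ LinearMap.mulLeft k g).lTensor H t) := by
        intro t
        induction t using TensorProduct.induction_on with
        | zero => simp
        | tmul a b => simp
        | add a b ha hb => simp only [mul_add, map_add, ha, hb]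
      rw [← hg.comul_eq_tmul_self] at this
      have h2 := this (comul (R := k) y)
      rwa [← Bialgebra.comul_mul] at h2
    rw [h.rightHit_eq, ← hgdef] at h1
    apply hg.isUnit.mul_left_cancel
    rw [← h1, mul_smul_comm, mul_one]
  obtain ⟨q, rfl⟩ := h.exists_leftHit x
  change (φ ∘ₗ antipode k) (leftHit q L) = (φ ∘ₗ LinearMap.mulLeft k g) (leftHit q L)
  rw [← apply_rightHit, ← apply_rightHit, hμ, h.rightHit_antipode_integral, hL.left,
    hg.counit_eq_one, one_smul, h.apply_integral, one_smul]

theorem eq_of_forall (h : IsDualForm L φ) {a b : H} (hab : ∀ x, φ (a * x) = φ (b * x)) : a = b := by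
  rw [← h.right a, ← h.right b]
  simp only [hab]

/-- Radford's formula for the fourth power of the antipode. -/
theorem antipode_four (h : IsDualForm L φ) (hL : IsIdempotentIntegral k L) (a : H) :
    antipode k (antipode k (antipode k (antipode k a))) * rightHit φ L = rightHit φ L * a := by
  refine (h.eq_of_forall fun b => ?_).symm
  -- φ(g a b) = φ(S(b) S(a)) = φ(S³(a) S(b)) = φ(S(b S²(a))) = φ(g b S²(a)) = φ(S⁴(a) g b).
  rw [mul_assoc, ← h.apply_antipode hL, antipode_mul_antidistrib, h.nakayama,
    ← antipode_mul_antidistrib, h.apply_antipode hL, ← mul_assoc, h.nakayama, ← mul_assoc]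

theorem trace_eq (h : IsDualForm L φ) [Module.Finite k H] (F : Module.End k H) :
    LinearMap.trace k H F =
      ∑ i ∈ (ℛ k L).index, φ (antipode k ((ℛ k L).right i) * F ((ℛ k L).left i)) := by
  have : F = ∑ i ∈ (ℛ k L).index,
      (φ ∘ₗ LinearMap.mulLeft k (antipode k ((ℛ k L).right i))).smulRight (F ((ℛ k L).left i)) := by
    ext a
    conv_lhs => rw [← h.left a, map_sum]
    simp
  conv_lhs => rw [this, map_sum]
  simp

/-- With y = `leftHit f L`, the dual systems turn the trace into φ(S(∑ S(y₁) y₂)) = ε(y) φ(1), and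
ε(y) = f(L). -/
theorem trace_antipode_sq_leftHit (h : IsDualForm L φ) [Module.Finite k H] (f : H →ₗ[k] k) :
    LinearMap.trace k H (antipode k ∘ₗ antipode k ∘ₗ leftHit f) = φ 1 * f L := by
  rw [h.trace_eq]
  let Ψ : H ⊗[k] H →ₗ[k] k := φ ∘ₗ antipode k ∘ₗ LinearMap.mul' k H ∘ₗ (antipode k).rTensor H
  have h1 : Ψ (comul (R := k) (leftHit f L)) = φ 1 * f L := by
    simp only [Ψ, LinearMap.comp_apply, mul_antipode_rTensor_comul_apply, counit_leftHit]
    rw [Algebra.algebraMap_eq_smul_one, map_smul, map_smul, antipode_one, smul_eq_mul, mul_comm]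
  rw [← h1, comul_leftHit, ← (ℛ k L).eq]
  simp [Ψ, antipode_mul_antidistrib]

theorem trace_antipode_sq (h : IsDualForm L φ) (hL : IsIdempotentIntegral k L)
    [Module.Finite k H] :
    LinearMap.trace k H (antipode k ∘ₗ antipode k) = φ 1 := by
  have h1 := h.trace_antipode_sq_leftHit (counit (R := k))
  have h2 : leftHit (counit (R := k) (A := H)) = .id := by
    ext x; simp [leftHit]
  rwa [h2, LinearMap.comp_id, hL.counit_eq_one, mul_one] at h1

/-- Evaluating `rightHit_eq` at 1 gives φ(1)·1 = φ(1) g, so g = 1. -/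
theorem antipode_four_eq (h : IsDualForm L φ) (hL : IsIdempotentIntegral k L) (h1 : φ 1 ≠ 0)
    (a : H) : antipode k (antipode k (antipode k (antipode k a))) = a := by
  have hg : rightHit φ L = 1 := by
    have := h.rightHit_eq 1
    rw [rightHit_one] at this
    exact (smul_right_injective H h1 this).symm
  simpa [hg] using h.antipode_four hL a

end IsDualForm

theorem trace_eq_finrank_of_isIdempotentElem {M : Type*} [AddCommGroup M] [Module k M]
    [Module.Finite k M] {e : Module.End k M} (he : IsIdempotentElem e) :
    LinearMap.trace k M e = Module.finrank k (LinearMap.range e) :=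
  (LinearMap.IsIdempotentElem.isProj_range e he).trace

theorem regularCharacter_antipode_antipode [Module.Finite k H]
    (hS : ∀ a : H, antipode k (antipode k (antipode k (antipode k a))) = a) :
    regularCharacter k H ∘ₗ antipode k ∘ₗ antipode k = regularCharacter k H := by
  ext h
  let σ : Module.End k H := antipode k ∘ₗ antipode k
  have hσ : σ * σ = 1 := by ext a; exact hS a
  have h1 : LinearMap.mul k H (antipode k (antipode k h)) = σ * LinearMap.mul k H h * σ := by
    ext a
    simp [σ, antipode_mul_antidistrib, hS]
  simp only [regularCharacter, LinearMap.comp_apply]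
  rw [h1, LinearMap.trace_mul_comm, ← mul_assoc, hσ, one_mul]

/-- The Larson–Radford theorem, for a form with nonzero value at `1`. -/
theorem IsDualForm.antipode_antipode [CharZero k] {φ : H →ₗ[k] k} (h : IsDualForm L φ)
    (hL : IsIdempotentIntegral k L) (h1 : φ 1 ≠ 0) (a : H) : antipode k (antipode k a) = a := by
  have hfin := hL.finite
  have hnt : Nontrivial H := ⟨L, 0, hL.ne_zero⟩
  have hS := h.antipode_four_eq hL h1
  set σ : Module.End k H := antipode k ∘ₗ antipode k with hσdef
  set P : Module.End k H := leftHit (regularCharacter k H) with hPdef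
  set d := Module.finrank k H with hd
  have hd0 : (d : k) ≠ 0 := Nat.cast_ne_zero.2 Module.finrank_pos.ne'
  have hσ : σ * σ = 1 := by ext a; exact hS a
  have hcomm : Commute σ P := by
    ext x
    change σ (leftHit _ x) = leftHit _ (antipode k (antipode k x))
    rw [leftHit_antipode_antipode, regularCharacter_antipode_antipode hS]
    rfl
  have hP : P * P = (d : k) • P := by
    ext x
    change leftHit _ (leftHit _ x) = (d : k) • leftHit _ x
    have : regularCharacter k H ∘ₗ leftHit (regularCharacter k H) =
        (d : k) • regularCharacter k H := by
      ext y
      exact regularCharacter_leftHit y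
    rw [leftHit_leftHit, this]
    simp [leftHit, LinearMap.rTensor_smul]
  have hq : IsIdempotentElem ((2⁻¹ : k) • (1 + σ)) := by
    rw [IsIdempotentElem, smul_mul_smul_comm, mul_add, add_mul, add_mul, hσ, mul_one, one_mul,
      mul_one]
    module
  have he : IsIdempotentElem ((d : k)⁻¹ • P) := by
    rw [IsIdempotentElem, smul_mul_smul_comm, hP, smul_smul]
    congr 1
    field_simp
  have hqe : IsIdempotentElem (((2⁻¹ : k) • (1 + σ)) * ((d : k)⁻¹ • P)) :=
    IsIdempotentElem.mul_of_commute
      ((((Commute.one_left P).add_left hcomm).smul_left _).smul_right _) hq he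
  -- The idempotents (1 + S²)/2, P/d and their product have natural traces r, m2, m3. Since S² and
  -- S²P both have trace φ(1), it follows that φ(1) = 2r − d = d(2m3 − m2). Thus d divides the
  -- nonzero integer 2r − d, and 0 ≤ r ≤ d leaves only r = 0 or r = d.
  have t1 := trace_eq_finrank_of_isIdempotentElem hq
  obtain ⟨m2, t2⟩ : ∃ m : ℕ, LinearMap.trace k H _ = m :=
    ⟨_, trace_eq_finrank_of_isIdempotentElem he⟩
  obtain ⟨m3, t3⟩ : ∃ m : ℕ, LinearMap.trace k H _ = m :=
    ⟨_, trace_eq_finrank_of_isIdempotentElem hqe⟩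
  have trσ : LinearMap.trace k H σ = φ 1 := h.trace_antipode_sq hL
  have trσP : LinearMap.trace k H (σ * P) = φ 1 := by
    have := h.trace_antipode_sq_leftHit (regularCharacter k H)
    rwa [regularCharacter_integral hL, mul_one] at this
  have hr := Submodule.finrank_le (LinearMap.range ((2⁻¹ : k) • (1 + σ)))
  set r := Module.finrank k (LinearMap.range ((2⁻¹ : k) • (1 + σ))) with hrdef
  rw [map_smul, map_add, LinearMap.trace_one, trσ, smul_eq_mul] at t1
  rw [map_smul, smul_eq_mul] at t2
  rw [smul_mul_smul_comm, map_smul, add_mul, one_mul, map_add, trσP, smul_eq_mul] at t3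
  have e1 : φ 1 = 2 * r - d := by rw [← t1]; ring
  have e2 : φ 1 = d * (2 * m3 - m2) := by
    rw [← t3, ← t2]; field_simp; ring
  have e3 : (2 * r - d : ℤ) = d * (2 * m3 - m2) := by
    have := e1.symm.trans e2
    exact_mod_cast this
  have e4 : (2 * r - d : ℤ) ≠ 0 := by
    intro h0
    apply h1
    rw [e1]
    exact_mod_cast h0
  have hdpos : 0 < d := Module.finrank_pos
  have hrd : r = 0 ∨ r = d := by
    have hz : (2 * m3 - m2 : ℤ) ≠ 0 := by
      intro h0
      rw [h0, mul_zero] at e3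
      exact e4 e3
    rcases lt_or_gt_of_ne hz with hz | hz
    · left; nlinarith
    · right
      have : (d : ℤ) ≤ r := by nlinarith
      omega
  rcases hrd with h0 | h0
  -- Here r = 0 would mean S² = −1, contradicting S²(1) = 1.
  · exfalso
    rw [hrdef, Submodule.finrank_eq_zero, LinearMap.range_eq_bot] at h0
    have := congrArg (fun F : Module.End k H => F 1) h0
    simp only [σ, LinearMap.smul_apply, LinearMap.add_apply, Module.End.one_apply,
      LinearMap.comp_apply, antipode_one, LinearMap.zero_apply] at this
    rw [← two_smul k (1 : H), smul_smul, inv_mul_cancel₀ two_ne_zero, one_smul] at this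
    exact one_ne_zero this
  · have htop : LinearMap.range ((2⁻¹ : k) • (1 + σ)) = ⊤ :=
      Submodule.eq_top_of_finrank_eq h0
    have hone : ((2⁻¹ : k) • (1 + σ)) = 1 := by
      ext x
      obtain ⟨y, rfl⟩ := LinearMap.range_eq_top.1 htop x
      exact congrArg (fun F : Module.End k H => F y) hq
    have := congrArg (fun F : Module.End k H => (2 : k) • F a - a) hone
    simpa [σ, two_smul] using this

end Frobenius

/-! ### Positivity for cyclotomic integers -/

section RootsOfUnity

open Polynomial

/-- In both fields the minimal polynomial over ℤ is the M-th cyclotomic polynomial; this transports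
identities from `K` to ℂ. -/
theorem aeval_eq_zero_iff_of_isPrimitiveRoot {K K' : Type*} [Field K] [CharZero K] [Field K']
    [CharZero K'] {M : ℕ} (hM : 0 < M) {ζ : K} {ζ' : K'} (hζ : IsPrimitiveRoot ζ M)
    (hζ' : IsPrimitiveRoot ζ' M) (P : ℤ[X]) : aeval ζ P = 0 ↔ aeval ζ' P = 0 := by
  rw [minpoly.isIntegrallyClosed_dvd_iff (hζ.isIntegral hM),
    minpoly.isIntegrallyClosed_dvd_iff (hζ'.isIntegral hM),
    ← cyclotomic_eq_minpoly hζ hM, ← cyclotomic_eq_minpoly hζ' hM]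

theorem pow_sub_one_eq_inv {K : Type*} [Field K] {M : ℕ} (hM : 0 < M) {ζ : K}
    (hζ : IsPrimitiveRoot ζ M) : ζ ^ (M - 1) = ζ⁻¹ := by
  rw [pow_sub₀ _ (hζ.ne_zero hM.ne') hM, hζ.pow_eq_one, one_mul, pow_one]

/-- A vanishing sum of products `Q(ζ) Q(ζ⁻¹)` has vanishing terms. -/
theorem aeval_eq_zero_of_sum_mul_inv_eq_zero {K : Type*} [Field K] [CharZero K] {M : ℕ}
    (hM : 0 < M) {ζ : K} (hζ : IsPrimitiveRoot ζ M) {ι : Type*} [Fintype ι] (Q : ι → ℤ[X])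
    (h : ∑ j, aeval ζ (Q j) * aeval ζ⁻¹ (Q j) = 0) (j : ι) : aeval ζ (Q j) = 0 := by
  have hξ : IsPrimitiveRoot (Complex.exp (2 * Real.pi * Complex.I / M)) M :=
    Complex.isPrimitiveRoot_exp M hM.ne'
  set ξ := Complex.exp (2 * Real.pi * Complex.I / M)
  have hnorm : ‖ξ‖ = 1 := hξ.norm'_eq_one hM.ne'
  have hconj : ∀ P : ℤ[X], aeval ξ⁻¹ P = (starRingEnd ℂ) (aeval ξ P) := by
    intro P
    rw [Complex.inv_eq_conj hnorm, aeval_def, aeval_def, hom_eval₂]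
    congr 1
    exact RingHom.ext_int _ _
  -- Substituting X^(M−1) for X stands for inversion, which on the complex unit circle is
  -- conjugation.
  have h1 : aeval ζ (∑ j, Q j * (Q j).comp (X ^ (M - 1))) = 0 := by
    simpa [aeval_comp, pow_sub_one_eq_inv hM hζ] using h
  rw [aeval_eq_zero_iff_of_isPrimitiveRoot hM hζ hξ] at h1
  simp only [map_sum, map_mul, aeval_comp, map_pow, aeval_X, pow_sub_one_eq_inv hM hξ, hconj, Complex.mul_conj]
    at h1
  have h2 : ∑ j, Complex.normSq (aeval ξ (Q j)) = 0 := by exact_mod_cast h1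
  rw [Finset.sum_eq_zero_iff_of_nonneg fun _ _ => Complex.normSq_nonneg _] at h2
  rw [aeval_eq_zero_iff_of_isPrimitiveRoot hM hζ hξ]
  exact Complex.normSq_eq_zero.1 (h2 j (Finset.mem_univ j))

end RootsOfUnity

/-! ### Traces of operators of finite order -/

section FiniteOrder

variable {k : Type*} [Field k] [CharZero k] {V : Type*} [AddCommGroup V] [Module k V]
  [Module.Finite k V]

open Polynomial in
/-- The traces of the powers of an endomorphism of finite order are given by an integral
polynomial in roots of unity. -/
theorem exists_trace_pow_eq_aeval {M : ℕ} (hM : 0 < M) {ζ : k} (hζ : IsPrimitiveRoot ζ M)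
    {h : Module.End k V} (hh : h ^ M = 1) :
    ∃ Q : ℤ[X], ∀ r : ℕ, LinearMap.trace k V (h ^ r) = aeval (ζ ^ r) Q := by
  have hM0 : (M : k) ≠ 0 := Nat.cast_ne_zero.2 hM.ne'
  have hζ0 := hζ.ne_zero hM.ne'
  -- The projection onto the ζ^i-eigenspace of h; its rank is the coefficient of X^i in Q.
  let p : ℕ → Module.End k V := fun i =>
    (M : k)⁻¹ • ∑ s ∈ Finset.range M, (ζ ^ i)⁻¹ ^ s • h ^ s
  have hp : ∀ i, h * p i = ζ ^ i • p i := by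
    intro i
    have h1 : ζ ^ i • ∑ s ∈ Finset.range M, (ζ ^ i)⁻¹ ^ (s + 1) • h ^ (s + 1) =
        h * ∑ s ∈ Finset.range M, (ζ ^ i)⁻¹ ^ s • h ^ s := by
      rw [Finset.smul_sum, Finset.mul_sum]
      refine Finset.sum_congr rfl fun s _ => ?_
      rw [smul_smul, mul_smul_comm, ← pow_succ', pow_succ' _ s, ← mul_assoc,
        mul_inv_cancel₀ (pow_ne_zero _ hζ0), one_mul]
    have h2 : ∑ s ∈ Finset.range M, (ζ ^ i)⁻¹ ^ (s + 1) • h ^ (s + 1) =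
        ∑ s ∈ Finset.range M, (ζ ^ i)⁻¹ ^ s • h ^ s := by
      have e1 := Finset.sum_range_succ (fun s => (ζ ^ i)⁻¹ ^ s • h ^ s) M
      have e2 := Finset.sum_range_succ' (fun s => (ζ ^ i)⁻¹ ^ s • h ^ s) M
      have e3 : (ζ ^ i)⁻¹ ^ M = 1 := by
        rw [inv_pow, ← pow_mul, mul_comm, pow_mul, hζ.pow_eq_one, one_pow, inv_one]
      rw [e1, e3, hh, pow_zero, pow_zero] at e2
      exact (add_right_cancel e2).symm
    simp only [p]
    rw [mul_smul_comm, ← h1, h2, smul_comm]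
  have hpr : ∀ i r, h ^ r * p i = (ζ ^ i) ^ r • p i := by
    intro i r
    induction r with
    | zero => simp
    | succ r ih => rw [pow_succ, mul_assoc, hp, mul_smul_comm, ih, smul_smul, pow_succ']
  have hidem : ∀ i, IsIdempotentElem (p i) := by
    intro i
    rw [IsIdempotentElem]
    conv_lhs => enter [1]; simp only [p]
    rw [smul_mul_assoc, Finset.sum_mul]
    simp only [smul_mul_assoc, hpr, smul_smul, ← mul_pow]
    rw [inv_mul_cancel₀ (pow_ne_zero _ hζ0)]
    simp only [one_pow, one_smul, Finset.sum_const, Finset.card_range]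
    rw [← Nat.cast_smul_eq_nsmul k, smul_smul, inv_mul_cancel₀ hM0, one_smul]
  have hsum : ∑ i ∈ Finset.range M, p i = 1 := by
    simp only [p]
    rw [← Finset.smul_sum, Finset.sum_comm, Finset.sum_eq_single 0]
    · simp only [pow_zero, one_smul, Finset.sum_const, Finset.card_range]
      rw [← Nat.cast_smul_eq_nsmul k, smul_smul, inv_mul_cancel₀ hM0, one_smul]
    · intro s hs hs0
      rw [← Finset.sum_smul]
      have hx : ζ ^ s ≠ 1 := by
        intro h1
        exact Nat.not_dvd_of_pos_of_lt (Nat.pos_of_ne_zero hs0) (Finset.mem_range.1 hs)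
          (hζ.dvd_of_pow_eq_one s h1)
      have hx' : (ζ ^ s)⁻¹ - 1 ≠ 0 := by
        rw [sub_ne_zero]
        exact fun h1 => hx (inv_eq_one.1 h1)
      have hg := geom_sum_mul ((ζ ^ s)⁻¹) M
      rw [inv_pow (ζ ^ s) M, ← pow_mul, mul_comm s M, pow_mul, hζ.pow_eq_one, one_pow, inv_one,
        sub_self] at hg
      have hg' := (mul_eq_zero.1 hg).resolve_right hx'
      have : ∑ i ∈ Finset.range M, (ζ ^ i)⁻¹ ^ s = ∑ i ∈ Finset.range M, (ζ ^ s)⁻¹ ^ i := by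
        refine Finset.sum_congr rfl fun i _ => ?_
        rw [inv_pow, inv_pow, ← pow_mul, ← pow_mul, mul_comm]
      rw [this, hg', zero_smul]
    · intro h0
      exact absurd (Finset.mem_range.2 hM) h0
  refine ⟨∑ i ∈ Finset.range M,
    (Module.finrank k (LinearMap.range (p i)) : ℤ[X]) * X ^ i, fun r => ?_⟩
  conv_lhs => rw [← mul_one (h ^ r), ← hsum, Finset.mul_sum, map_sum]
  rw [map_sum]
  refine Finset.sum_congr rfl fun i _ => ?_
  rw [hpr, map_smul, trace_eq_finrank_of_isIdempotentElem (hidem i), smul_eq_mul, mul_comm]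
  simp [← pow_mul, mul_comm]

end FiniteOrder

/-! ### Nonvanishing of φ(1) and involutivity of the antipode -/

section Nonvanishing

variable {k : Type u} {H : Type v} [Field k] [Ring H] [HopfAlgebra k H] {L : H}

theorem exists_pow_eq_one_of_isGroupLikeElem [Module.Finite k H] {g : H}
    (hg : IsGroupLikeElem k g) : ∃ N : ℕ, 0 < N ∧ g ^ N = 1 := by
  have : Finite (GroupLike k H) := (linearIndep_groupLikeVal (R := k) (A := H)).finite
  let G : GroupLike k H := ⟨g, hg⟩
  exact ⟨orderOf G, orderOf_pos G, by
    have := congrArg GroupLike.val (pow_orderOf_eq_one G)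
    rwa [GroupLike.val_pow, GroupLike.val_one] at this⟩

variable [IsAlgClosed k] [CharZero k] [IsSemisimpleRing H] {n : ℕ} {V : Fin n → Type w}
  [∀ i, AddCommGroup (V i)] [∀ i, Module k (V i)]
  [∀ i, Module H (V i)] [∀ i, IsScalarTower k H (V i)]

theorem IsIdempotentIntegral.isDualForm (hL : IsIdempotentIntegral k L)
    (hV : IsCompleteSimpleFamily H V) {t : H} (ht : t * twist k L = 1) (ht' : twist k L * t = 1) :
    IsDualForm L (weightedCharacter k V t) where
  left := hL.sum_weightedCharacter_left hV ht
  right := hL.sum_weightedCharacter_right hV ht'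
  nakayama := hL.weightedCharacter_mul ht ht'
  antipode_injective := hL.antipode_injective hV

/-- Both u² and g implement S⁴, so z = g⁻¹u² is central. With g^N = 1 this gives u^(2N) = z^N. -/
theorem IsIdempotentIntegral.exists_twist_pow_commute (hL : IsIdempotentIntegral k L)
    (hV : IsCompleteSimpleFamily H V) :
    ∃ M : ℕ, 0 < M ∧ ∀ a : H, twist k L ^ M * a = a * twist k L ^ M := by
  have := hL.finite
  obtain ⟨U, hU⟩ := hL.isUnit_twist hV
  have hφ := hL.isDualForm hV (t := ((U⁻¹ : Hˣ) : H)) (by rw [← hU]; simp) (by rw [← hU]; simp)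
  obtain ⟨N, hN, hgN⟩ := exists_pow_eq_one_of_isGroupLikeElem hφ.isGroupLikeElem
  obtain ⟨G, hG⟩ := hφ.isGroupLikeElem.isUnit
  have h4 := hφ.antipode_four hL
  rw [← hG] at hgN h4
  set z : H := ((G⁻¹ : Hˣ) : H) * twist k L ^ 2 with hz
  have hzc : ∀ a, Commute z a := by
    intro a
    have h1 : twist k L ^ 2 * a =
        antipode k (antipode k (antipode k (antipode k a))) * twist k L ^ 2 := by
      rw [pow_two, mul_assoc, hL.twist_mul a, ← mul_assoc,
        hL.twist_mul (antipode k (antipode k a)), mul_assoc]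
    have h2 : ((G⁻¹ : Hˣ) : H) * antipode k (antipode k (antipode k (antipode k a))) =
        a * ((G⁻¹ : Hˣ) : H) := by
      rw [Units.inv_mul_eq_iff_eq_mul, ← mul_assoc, ← h4, mul_assoc, Units.mul_inv, mul_one]
    change z * a = a * z
    rw [hz, mul_assoc, h1, ← mul_assoc, h2, mul_assoc]
  have hu : twist k L ^ 2 = (G : H) * z := by rw [hz, Units.mul_inv_cancel_left]
  refine ⟨2 * N, by omega, fun a => ?_⟩
  rw [pow_mul, hu, (hzc _).symm.mul_pow, hgN, one_mul]
  exact (hzc a).pow_left N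

theorem IsIdempotentIntegral.weightedCharacter_one_ne_zero [NeZero n]
    (hL : IsIdempotentIntegral k L)
    (hV : IsCompleteSimpleFamily H V) {t : H} (ht : t * twist k L = 1) (ht' : twist k L * t = 1) :
    weightedCharacter k V t 1 ≠ 0 := by
  obtain ⟨M, hM, hc⟩ := hL.exists_twist_pow_commute hV
  have hMk : NeZero (M : k) := ⟨Nat.cast_ne_zero.2 hM.ne'⟩
  obtain ⟨ζ, hζ⟩ := HasEnoughRootsOfUnity.exists_primitiveRoot k M
  have hfin := hL.finite_simple hV
  have hsim := hV.simple
  have hQ : ∀ j, ∃ (Q : Polynomial ℤ) (x : k), x ≠ 0 ∧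
      character k H (V j) (twist k L) = x * Polynomial.aeval ζ Q ∧
      character k H (V j) t = x⁻¹ * Polynomial.aeval ζ⁻¹ Q := by
    intro j
    have hnt : Nontrivial (V j) := IsSimpleModule.nontrivial H (V j)
    let F : V j →ₗ[H] V j :=
      { toFun := fun v => twist k L ^ M • v
        map_add' := fun v w => smul_add _ v w
        map_smul' := fun a v => by
          rw [RingHom.id_apply, ← mul_smul, ← mul_smul, hc] }
    obtain ⟨c, hcF⟩ := (IsSimpleModule.algebraMap_end_bijective_of_isAlgClosed
      (A := H) (V := V j) k).2 F
    have hρ : rho k (V j) (twist k L) ^ M = c • (1 : Module.End k (V j)) := by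
      rw [← map_pow]
      ext v
      have := congrArg (fun F : V j →ₗ[H] V j => F v) hcF
      exact this.symm
    have hut : rho k (V j) (twist k L) * rho k (V j) t = 1 := by rw [← map_mul, ht', map_one]
    have htu : rho k (V j) t * rho k (V j) (twist k L) = 1 := by rw [← map_mul, ht, map_one]
    have hcomm : Commute (rho k (V j) (twist k L)) (rho k (V j) t) := hut.trans htu.symm
    have hc0 : c ≠ 0 := by
      rintro rfl
      have : (rho k (V j) (twist k L) * rho k (V j) t) ^ M = 0 := by
        rw [hcomm.mul_pow, hρ, zero_smul, zero_mul]
      rw [hut, one_pow] at this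
      exact one_ne_zero this
    -- Dividing u by an M-th root of the scalar u^M makes it of finite order; x cancels in χ_j(u)
    -- χ_j(u⁻¹).
    obtain ⟨x, hx⟩ := IsAlgClosed.exists_pow_nat_eq c hM
    have hx0 : x ≠ 0 := by
      rintro rfl
      rw [zero_pow hM.ne'] at hx
      exact hc0 hx.symm
    have hh : (x⁻¹ • rho k (V j) (twist k L)) ^ M = 1 := by
      rw [smul_pow, hρ, inv_pow, hx, smul_smul, inv_mul_cancel₀ hc0, one_smul]
    obtain ⟨Q, hQ⟩ := exists_trace_pow_eq_aeval hM hζ hh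
    have hhinv : (x⁻¹ • rho k (V j) (twist k L)) ^ (M - 1) = x • rho k (V j) t := by
      have e1 : (x⁻¹ • rho k (V j) (twist k L)) ^ (M - 1) * (x⁻¹ • rho k (V j) (twist k L)) = 1 := by
        rw [← pow_succ, Nat.sub_add_cancel hM, hh]
      have e2 : (x⁻¹ • rho k (V j) (twist k L)) * (x • rho k (V j) t) = 1 := by
        rw [smul_mul_smul_comm, hut, inv_mul_cancel₀ hx0, one_smul]
      exact left_inv_eq_right_inv e1 e2
    refine ⟨Q, x, hx0, ?_, ?_⟩
    · have := hQ 1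
      rw [pow_one, pow_one, map_smul, smul_eq_mul] at this
      rw [← this, ← mul_assoc, mul_inv_cancel₀ hx0, one_mul, character_apply]
    · have := hQ (M - 1)
      rw [hhinv, pow_sub_one_eq_inv hM hζ, map_smul, smul_eq_mul] at this
      rw [← this, ← mul_assoc, inv_mul_cancel₀ hx0, one_mul, character_apply]
  choose Q x hx0 h1 h2 using hQ
  intro h0
  rw [weightedCharacter_apply] at h0
  have hsum : ∑ j, Polynomial.aeval ζ (Q j) * Polynomial.aeval ζ⁻¹ (Q j) = 0 := by
    rw [← h0]
    refine Finset.sum_congr rfl fun j _ => ?_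
    have := hx0 j
    rw [mul_one, ← hL.character_twist (V := V j), h1, h2]
    field_simp
  -- Any index would serve; triviality of V 0 plays no role.
  have hzero := aeval_eq_zero_of_sum_mul_inv_eq_zero hM hζ Q hsum 0
  have h3 := h1 0
  have hnt : Nontrivial (V 0) := IsSimpleModule.nontrivial H (V 0)
  rw [hzero, mul_zero, hL.character_twist] at h3
  exact (Nat.cast_ne_zero.2 Module.finrank_pos.ne') h3

/-- The antipode of a semisimple Hopf algebra in characteristic zero is an involution. -/
theorem IsIdempotentIntegral.antipode_antipode [NeZero n] (hL : IsIdempotentIntegral k L)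
    (hV : IsCompleteSimpleFamily H V) (a : H) : antipode k (antipode k a) = a := by
  obtain ⟨U, hU⟩ := hL.isUnit_twist hV
  have ht : ((U⁻¹ : Hˣ) : H) * twist k L = 1 := by rw [← hU]; simp
  have ht' : twist k L * ((U⁻¹ : Hˣ) : H) = 1 := by rw [← hU]; simp
  exact (hL.isDualForm hV ht ht').antipode_antipode hL
    (hL.weightedCharacter_one_ne_zero hV ht ht') a

/-- As S² = 1, S(L₂) L₁ = S(S(L₁) L₂), which sums to S(ε(L) 1) = 1. -/
theorem IsIdempotentIntegral.twist_eq_one [NeZero n] (hL : IsIdempotentIntegral k L)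
    (hV : IsCompleteSimpleFamily H V) : twist k L = 1 := by
  have hS := hL.antipode_antipode hV
  rw [twist]
  have h1 := congrArg (antipode k) (sum_antipode_mul_eq_smul (R := k) (ℛ k L))
  rw [map_sum, hL.counit_eq_one, one_smul, antipode_one] at h1
  simpa [antipode_mul_antidistrib, hS] using h1

end Nonvanishing

/-! ### Tensor products and duals of representations -/

section Representations

variable {k : Type u} {H : Type v} [Field k] [Ring H] [HopfAlgebra k H]
  {M N : Type*} [AddCommGroup M] [Module k M] [AddCommGroup N] [Module k N]

/-- The tensor product of two representations of a Hopf algebra. -/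
def tensorRep (ρ : H →ₐ[k] Module.End k M) (τ : H →ₐ[k] Module.End k N) :
    H →ₐ[k] Module.End k (M ⊗[k] N) :=
  (Module.endTensorEndAlgHom.comp (Algebra.TensorProduct.map ρ τ)).comp
    (Bialgebra.comulAlgHom k H)

/-- The dual of a representation of a Hopf algebra. -/
def dualRep (ρ : H →ₐ[k] Module.End k M) : H →ₐ[k] Module.End k (Module.Dual k M) :=
  AlgHom.ofLinearMap (Module.Dual.transpose ∘ₗ ρ.toLinearMap ∘ₗ antipode k)
    (by ext; simp [Module.Dual.transpose])
    (fun x y => by ext; simp [Module.Dual.transpose, antipode_mul_antidistrib])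

theorem conv_ofConv_apply (p q : H →ₗ[k] k) (h : H) :
    (WithConv.toConv p * WithConv.toConv q).ofConv h = p (rightHit q h) := by
  refine ((ℛ k h).convMul_apply _ _).trans ?_
  rw [rightHit_repr q (ℛ k h)]
  simp [mul_comm]

variable [Module.Finite k M] [Module.Finite k N]

theorem trace_tensorRep (ρ : H →ₐ[k] Module.End k M) (τ : H →ₐ[k] Module.End k N) :
    LinearMap.trace k (M ⊗[k] N) ∘ₗ (tensorRep ρ τ).toLinearMap =
      (WithConv.toConv (LinearMap.trace k M ∘ₗ ρ.toLinearMap) *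
        WithConv.toConv (LinearMap.trace k N ∘ₗ τ.toLinearMap)).ofConv := by
  ext h
  rw [conv_ofConv_apply, rightHit_repr _ (ℛ k h)]
  simp only [LinearMap.comp_apply, AlgHom.toLinearMap_apply, tensorRep, AlgHom.comp_apply,
    Bialgebra.comulAlgHom_apply]
  rw [← (ℛ k h).eq]
  simp only [map_sum, Algebra.TensorProduct.map_tmul, Module.endTensorEndAlgHom_apply, map_smul]
  refine Finset.sum_congr rfl fun i _ => ?_
  rw [smul_eq_mul, mul_comm]
  exact LinearMap.trace_tensorProduct' _ _

theorem trace_dualRep (ρ : H →ₐ[k] Module.End k M) :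
    LinearMap.trace k (Module.Dual k M) ∘ₗ (dualRep ρ).toLinearMap =
      dualAntipode k (LinearMap.trace k M ∘ₗ ρ.toLinearMap) := by
  ext h
  exact LinearMap.trace_transpose' (ρ (antipode k h))

theorem exists_natCast_eq_trace {L : H} (hL : IsIdempotentElem L) (ρ : H →ₐ[k] Module.End k M) :
    ∃ m : ℕ, (LinearMap.trace k M ∘ₗ ρ.toLinearMap) L = m :=
  ⟨_, trace_eq_finrank_of_isIdempotentElem (hL.map ρ)⟩

end Representations

/-! ### Tracial functionals and central elements -/

section Tracial

variable {k : Type u} {H : Type v} [Field k] [Ring H] [HopfAlgebra k H]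

theorem conv_mul_comm {p q : H →ₗ[k] k} (hp : ∀ x y, p (x * y) = p (y * x))
    (hq : ∀ x y, q (x * y) = q (y * x)) (x y : H) :
    p (rightHit q (x * y)) = p (rightHit q (y * x)) := by
  have key : ∀ s t : H ⊗[k] H, p (TensorProduct.rid k H (q.lTensor H (s * t))) =
      p (TensorProduct.rid k H (q.lTensor H (t * s))) := by
    intro s t
    induction s using TensorProduct.induction_on with
    | zero => simp
    | tmul a b =>
      induction t using TensorProduct.induction_on with
      | zero => simp
      | tmul c d => simp [hp a c, hq b d]
      | add c d hc hd => simp only [mul_add, add_mul, map_add, hc, hd]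
    | add a b ha hb => simp only [mul_add, add_mul, map_add, ha, hb]
  have := key (comul (R := k) x) (comul (R := k) y)
  rwa [← Bialgebra.comul_mul, ← Bialgebra.comul_mul] at this

theorem dualAntipode_mul_comm {p : H →ₗ[k] k} (hp : ∀ x y, p (x * y) = p (y * x)) (x y : H) :
    dualAntipode k p (x * y) = dualAntipode k p (y * x) := by
  simp only [dualAntipode, LinearMap.comp_apply, antipode_mul_antidistrib]
  exact hp _ _

/-- The Casimir identity with S² = 1 gives h ∑ f(L₂) L₁ = ∑ f(S(h) L₂) L₁, while right
multiplication by h gives ∑ f(L₂ S(h)) L₁; traciality identifies them. -/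
theorem IsIdempotentIntegral.commute_rightHit {L : H} (hL : IsIdempotentIntegral k L)
    (hS : ∀ a : H, antipode k (antipode k a) = a) {f : H →ₗ[k] k}
    (hf : ∀ x y, f (x * y) = f (y * x)) (h : H) : h * rightHit f L = rightHit f L * h := by
  have h1 := hL.sum_apply_mul
    ((LinearMap.lsmul k H ∘ₗ f ∘ₗ antipode k).flip) h
  rw [hL.rightHit_mul, rightHit_repr f (ℛ k L), rightHit_repr _ (ℛ k L), Finset.mul_sum]
  simpa [hS, antipode_mul_antidistrib, hf _ (antipode k h)] using h1

theorem hopfCommutator_sum_smul {ι : Type*} (s : Finset ι) (c : ι → k) (x : ι → H) (y : H) :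
    hopfCommutator k (∑ i ∈ s, c i • x i) y = ∑ i ∈ s, c i • hopfCommutator k (x i) y := by
  simp only [hopfCommutator, map_sum, map_smul, TensorProduct.sum_tmul, ← TensorProduct.smul_tmul']

end Tracial

/-! ### The trivial module -/

section Trivial

variable {k : Type u} {H : Type v} [Field k] [Ring H] [HopfAlgebra k H]

theorem rightHit_counit (h : H) : rightHit (counit (R := k)) h = h := by
  simp [rightHit]

variable {W : Type*} [AddCommGroup W] [Module k W] [Module H W] [IsSimpleModule H W]

theorem finrank_eq_one_of_trivial (h0 : ∀ (h : H) (v : W), h • v = counit (R := k) h • v) :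
    Module.finrank k W = 1 := by
  have hnt : Nontrivial W := IsSimpleModule.nontrivial H W
  obtain ⟨v, hv⟩ := exists_ne (0 : W)
  rw [finrank_eq_one_iff_of_nonzero' v hv]
  intro w
  obtain ⟨h, rfl⟩ := IsSimpleModule.toSpanSingleton_surjective H hv w
  exact ⟨counit (R := k) h, (h0 h v).symm⟩

theorem dualAntipode_character_trivial [IsScalarTower k H W]
    (h0 : ∀ (h : H) (v : W), h • v = counit (R := k) h • v) :
    dualAntipode k (character k H W) = counit := by
  have h1 := finrank_eq_one_of_trivial h0
  have hfin : Module.Finite k W := Module.finite_of_finrank_eq_succ h1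
  ext h
  have : rho k W (antipode k h) = counit (R := k) h • (1 : Module.End k W) := by
    ext v
    change antipode k h • v = counit (R := k) h • v
    rw [h0, counit_antipode]
  rw [dualAntipode, LinearMap.comp_apply, character_apply, this, map_smul, LinearMap.trace_one, h1,
    Nat.cast_one, smul_eq_mul, mul_one]

end Trivial

/-! ### The commutator matrix and the iterated commutators -/

section Main

variable {k : Type u} {H : Type v} [Field k] [Ring H]
  [HopfAlgebra k H] {L : H} {n : ℕ} {V : Fin n → Type w}
  [∀ i, AddCommGroup (V i)] [∀ i, Module k (V i)]
  [∀ i, Module H (V i)] [∀ i, IsScalarTower k H (V i)]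

theorem commutatorMatrix_apply (i j : Fin n) : commutatorMatrix k L V i j =
    character k H (V i) (rightHit (dualAntipode k (character k H (V i)) ∘ₗ
      rightHit (dualAntipode k (character k H (V j)))) L) / Module.finrank k (V j) := by
  have h1 : dualAntipode k (character k H (V i)) ∘ₗ
      rightHit (dualAntipode k (character k H (V j))) =
      (WithConv.toConv (dualAntipode k (character k H (V i))) *
        WithConv.toConv (dualAntipode k (character k H (V j)))).ofConv := by
    ext h
    rw [conv_ofConv_apply]
    rfl
  rw [h1, ← conv_ofConv_apply, WithConv.toConv_ofConv, ← mul_assoc]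
  rfl

theorem exists_commutatorMatrix_eq (hL : IsIdempotentElem L) [∀ i, Module.Finite k (V i)]
    (i j : Fin n) : ∃ m : ℕ, commutatorMatrix k L V i j = m / Module.finrank k (V j) := by
  obtain ⟨m, hm⟩ := exists_natCast_eq_trace hL
    (tensorRep (tensorRep (rho k (V i)) (dualRep (rho k (V i)))) (dualRep (rho k (V j))))
  refine ⟨m, ?_⟩
  rw [← hm, trace_tensorRep, trace_tensorRep, trace_dualRep, trace_dualRep]
  rfl

variable [IsAlgClosed k] [CharZero k] [IsSemisimpleRing H] [NeZero n]

/-- The central element attached to a character acts as the identity on that module and as zero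
on the others. -/
theorem IsIdempotentIntegral.rightHit_character_smul (hL : IsIdempotentIntegral k L)
    (hV : IsCompleteSimpleFamily H V) (i j : Fin n) (v : V j) :
    ((Module.finrank k (V i) : k) • rightHit (dualAntipode k (character k H (V i))) L) • v =
      (if i = j then (1 : k) else 0) • v := by
  have := hL.finite_simple hV
  have := hV.simple
  have hnt : Nontrivial (V i) := IsSimpleModule.nontrivial H (V i)
  have hd : (Module.finrank k (V i) : k) ≠ 0 := Nat.cast_ne_zero.2 Module.finrank_pos.ne'
  have hb : rightHit (dualAntipode k (character k H (V i))) L • v =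
      ∑ b, ∑ l ∈ (ℛ k L).index, (Module.finBasis k (V i)).coord b
        (antipode k ((ℛ k L).right l) • Module.finBasis k (V i) b) • (ℛ k L).left l • v := by
    rw [rightHit_repr _ (ℛ k L), Finset.sum_comm, Finset.sum_smul]
    refine Finset.sum_congr rfl fun l _ => ?_
    rw [dualAntipode, LinearMap.comp_apply, character_apply,
      trace_eq_sum_repr (Module.finBasis k (V i)), Finset.sum_smul, Finset.sum_smul]
    refine Finset.sum_congr rfl fun b _ => ?_
    rw [smul_assoc]
    rfl
  rw [smul_assoc, hb]
  split_ifs with hij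
  · subst hij
    simp only [hL.sum_smul_smul, hL.twist_eq_one hV, one_smul]
    rw [Finset.smul_sum]
    simp only [← smul_assoc, smul_eq_mul, mul_div_cancel₀ _ hd]
    exact (Module.finBasis k (V i)).sum_repr v
  · simp only [hL.sum_smul_smul_of_not_iso (fun h => hij (hV.not_iso i j h)),
      Finset.sum_const_zero, smul_zero, zero_smul]

/-- The right side e is a nonzero central idempotent, being 1 on V i and 0 on the other simples.
Then e E = e, and primitivity of E forces e = E. -/
theorem IsIdempotentIntegral.centralIdempotent_eq (hL : IsIdempotentIntegral k L)
    (hV : IsCompleteSimpleFamily H V) {E : H} (hE : IsCentralPrimitiveIdempotent E) {i : Fin n}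
    (hEV : ∀ v : V i, E • v = v) :
    E = (Module.finrank k (V i) : k) • rightHit (dualAntipode k (character k H (V i))) L := by
  have := hV.simple
  have hact := hL.rightHit_character_smul hV i
  set e := (Module.finrank k (V i) : k) • rightHit (dualAntipode k (character k H (V i))) L
  have hc : e ∈ Subring.center H := by
    rw [Subring.mem_center_iff]
    intro x
    refine hV.ext fun j v => ?_
    rw [mul_smul, mul_smul, hact, hact, smul_algebra_smul_comm]
  have hi : IsIdempotentElem e := by
    refine hV.ext fun j v => ?_
    rw [mul_smul, hact, hact]
    split_ifs <;> simp
  have hne : e ≠ 0 := by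
    intro h0
    have hnt : Nontrivial (V i) := IsSimpleModule.nontrivial H (V i)
    obtain ⟨v, hv⟩ := exists_ne (0 : V i)
    have := hact i v
    rw [h0, zero_smul, if_pos rfl, one_smul] at this
    exact hv this.symm
  have hm : e * E = e := by
    refine hV.ext fun j v => ?_
    rw [mul_smul, hact, hact]
    split_ifs with hij
    · subst hij
      rw [hEV]
    · simp
  exact ((hE.primitive e hc hi hm).resolve_left hne).symm

/-- In a₁ L₁ S(a₂) S(L₂) the last three factors form the average of S(a₂), which acts on V i as
χ_i(S(a₂))/d_i. -/
theorem IsIdempotentIntegral.hopfCommutator_smul (hL : IsIdempotentIntegral k L)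
    (hV : IsCompleteSimpleFamily H V) (a : H) (i : Fin n) (v : V i) :
    hopfCommutator k a L • v = (Module.finrank k (V i) : k)⁻¹ •
      rightHit (dualAntipode k (character k H (V i))) a • v := by
  have := hL.finite_simple hV
  have := hV.simple
  rw [hopfCommutator_eq_sum k (ℛ k a) (ℛ k L), rightHit_repr _ (ℛ k a), Finset.sum_smul,
    Finset.sum_smul, Finset.smul_sum]
  refine Finset.sum_congr rfl fun p _ => ?_
  have h1 := hL.average_eq_smul (rho k (V i) (antipode k ((ℛ k a).right p))) v
  rw [hL.twist_eq_one hV, map_one, one_mul, ← character_apply, hL.average_apply] at h1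
  have h2 := congrArg (fun w => (ℛ k a).left p • w) h1
  simp only [Finset.smul_sum, Algebra.lsmul_coe] at h2
  rw [Finset.sum_smul]
  simp only [mul_smul]
  rw [h2, smul_algebra_smul_comm, smul_assoc, smul_smul, div_eq_inv_mul]
  rfl

/-- The commutator acts as (d_j/d_i) Y with Y central, hence a scalar on V i; its trace there is
A_ij d_j, so the scalar of Y is A_ij d_j/d_i. -/
theorem IsIdempotentIntegral.hopfCommutator_character_smul (hL : IsIdempotentIntegral k L)
    (hV : IsCompleteSimpleFamily H V) (i j : Fin n) (v : V i) :
    hopfCommutator k ((Module.finrank k (V j) : k) •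
      rightHit (dualAntipode k (character k H (V j))) L) L • v =
      (commutatorMatrix k L V i j * (Module.finrank k (V j) : k) ^ 2 /
        (Module.finrank k (V i) : k) ^ 2) • v := by
  have hfin := hL.finite_simple hV
  have hsim := hV.simple
  have hnt : ∀ i, Nontrivial (V i) := fun i => IsSimpleModule.nontrivial H (V i)
  have hd : ∀ i, (Module.finrank k (V i) : k) ≠ 0 :=
    fun i => Nat.cast_ne_zero.2 Module.finrank_pos.ne'
  set Y := rightHit (dualAntipode k (character k H (V i)) ∘ₗ
      rightHit (dualAntipode k (character k H (V j)))) L with hY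
  have hYc : ∀ h, h * Y = Y * h :=
    hL.commute_rightHit (hL.antipode_antipode hV)
      (conv_mul_comm (dualAntipode_mul_comm character_mul_comm)
        (dualAntipode_mul_comm character_mul_comm))
  let F : V i →ₗ[H] V i :=
    { toFun := fun v => Y • v
      map_add' := fun v w => smul_add _ v w
      map_smul' := fun a v => by
        rw [RingHom.id_apply, ← mul_smul, ← mul_smul, hYc] }
  obtain ⟨c, hcF⟩ := (IsSimpleModule.algebraMap_end_bijective_of_isAlgClosed
    (A := H) (V := V i) k).2 F
  have hYv : ∀ v : V i, Y • v = c • v := fun v =>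
    (congrArg (fun F : V i →ₗ[H] V i => F v) hcF).symm
  have htr : character k H (V i) Y = c * Module.finrank k (V i) := by
    have : rho k (V i) Y = c • (1 : Module.End k (V i)) := by ext v; exact hYv v
    rw [character_apply, this, map_smul, LinearMap.trace_one, smul_eq_mul]
  rw [hL.hopfCommutator_smul hV, map_smul, rightHit_rightHit, ← hY, smul_assoc, hYv,
    commutatorMatrix_apply, ← hY, htr, smul_smul, smul_smul]
  congr 1
  have := hd i
  have := hd j
  field_simp

/-- Since s(χ_0) = ε and d_0 = 1, the entry is the trace on V i of d_i⁻¹ E_i, namely 1. -/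
theorem IsIdempotentIntegral.commutatorMatrix_zero (hL : IsIdempotentIntegral k L)
    (hV : IsCompleteSimpleFamily H V)
    (hV0 : ∀ (h : H) (v : V 0), h • v = counit (R := k) h • v) (i : Fin n) :
    commutatorMatrix k L V i 0 = 1 := by
  have hfin := hL.finite_simple hV
  have hsim := hV.simple
  have hnt : Nontrivial (V i) := IsSimpleModule.nontrivial H (V i)
  have hd : (Module.finrank k (V i) : k) ≠ 0 := Nat.cast_ne_zero.2 Module.finrank_pos.ne'
  have h1 : dualAntipode k (character k H (V i)) ∘ₗ rightHit (counit (R := k)) =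
      dualAntipode k (character k H (V i)) := by
    ext h
    rw [LinearMap.comp_apply, rightHit_counit]
  rw [commutatorMatrix_apply, dualAntipode_character_trivial hV0, h1,
    finrank_eq_one_of_trivial hV0, Nat.cast_one, div_one]
  have h2 : rho k (V i) ((Module.finrank k (V i) : k) •
      rightHit (dualAntipode k (character k H (V i))) L) = 1 := by
    ext v
    refine (hL.rightHit_character_smul hV i i v).trans ?_
    rw [if_pos rfl, one_smul]
    rfl
  have h3 := congrArg (LinearMap.trace k (V i)) h2
  rw [← character_apply, map_smul, LinearMap.trace_one, smul_eq_mul] at h3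
  exact mul_left_cancel₀ hd (h3.trans (mul_one _).symm)

theorem IsIdempotentIntegral.iteratedCommutator_eq (hL : IsIdempotentIntegral k L)
    (hV : IsCompleteSimpleFamily H V)
    (hV0 : ∀ (h : H) (v : V 0), h • v = counit (R := k) h • v)
    {E : Fin n → H} (hE : ∀ i, IsCentralPrimitiveIdempotent (E i))
    (hEV : ∀ (i : Fin n) (v : V i), E i • v = v) (m : ℕ) :
    iteratedCommutator k L m = ∑ i, ((commutatorMatrix k L V ^ m) i 0
      / (Module.finrank k (V i) : k) ^ 2) • E i := by
  have hsim := hV.simple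
  have hfin := hL.finite_simple hV
  have hnt : ∀ i, Nontrivial (V i) := fun i => IsSimpleModule.nontrivial H (V i)
  have hd : ∀ i, (Module.finrank k (V i) : k) ≠ 0 :=
    fun i => Nat.cast_ne_zero.2 Module.finrank_pos.ne'
  have hEe := fun i => hL.centralIdempotent_eq hV (hE i) (hEV i)
  have hEact : ∀ i j (v : V j), E i • v = (if i = j then (1 : k) else 0) • v := by
    intro i j v
    rw [hEe, hL.rightHit_character_smul hV]
  have hstep : ∀ j, hopfCommutator k (E j) L = ∑ i, (commutatorMatrix k L V i j *
      (Module.finrank k (V j) : k) ^ 2 / (Module.finrank k (V i) : k) ^ 2) • E i := by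
    intro j
    refine hV.ext fun i v => ?_
    rw [hEe j, hL.hopfCommutator_character_smul hV, Finset.sum_smul]
    simp [smul_assoc, hEact]
  induction m with
  | zero =>
    have hE0 : E 0 = L := by
      rw [hEe, dualAntipode_character_trivial hV0, rightHit_counit,
        finrank_eq_one_of_trivial hV0, Nat.cast_one, one_smul]
    rw [Finset.sum_eq_single 0]
    · simp [iteratedCommutator, hE0, finrank_eq_one_of_trivial hV0]
    · intro i _ hi
      simp [Matrix.one_apply_ne hi]
    · simp
  | succ m ih =>
    rw [iteratedCommutator, ih, hopfCommutator_sum_smul]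
    simp only [hstep, Finset.smul_sum, smul_smul]
    rw [Finset.sum_comm]
    refine Finset.sum_congr rfl fun i _ => ?_
    rw [← Finset.sum_smul, pow_succ' (commutatorMatrix k L V) m, Matrix.mul_apply, Finset.sum_div]
    congr 1
    refine Finset.sum_congr rfl fun j _ => ?_
    have := hd j
    have := hd i
    field_simp

/-- Induction on m: the entries of A are nonnegative rationals and A_i0 = 1, so the term j = 0 of
the product is already positive. -/
theorem IsIdempotentIntegral.exists_pos_rat_commutatorMatrix_pow (hL : IsIdempotentIntegral k L)
    (hV : IsCompleteSimpleFamily H V)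
    (hV0 : ∀ (h : H) (v : V 0), h • v = counit (R := k) h • v) (m : ℕ) (i : Fin n) :
    ∃ q : ℚ, 0 < q ∧ (commutatorMatrix k L V ^ (m + 1)) i 0 = q := by
  have hfin := hL.finite_simple hV
  choose N hN using exists_commutatorMatrix_eq (k := k) (V := V) hL.idem
  induction m generalizing i with
  | zero => exact ⟨1, one_pos, by simp [hL.commutatorMatrix_zero hV hV0]⟩
  | succ m ih =>
    choose q hq hqe using ih
    refine ⟨∑ j, (N i j / Module.finrank k (V j) : ℚ) * q j, ?_, ?_⟩
    · refine Finset.sum_pos' (fun j _ => mul_nonneg (by positivity) (hq j).le)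
        ⟨0, Finset.mem_univ _, mul_pos ?_ (hq 0)⟩
      have h1 := (hN i 0).symm.trans (hL.commutatorMatrix_zero hV hV0 i)
      have h2 : (N i 0 / Module.finrank k (V 0) : ℚ) = 1 := by
        apply Rat.cast_injective (α := k)
        push_cast
        exact h1
      rw [h2]
      exact one_pos
    · rw [pow_succ', Matrix.mul_apply]
      push_cast
      refine Finset.sum_congr rfl fun j _ => ?_
      rw [hN, hqe]

end Main

end CommutatorMatrix

end

theorem mainTheorem10 {k : Type*} {H : Type*} [Field k] [IsAlgClosed k] [CharZero k]
    [Ring H] [HopfAlgebra k H] [IsSemisimpleRing H]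
    (L : H) (hL : CommutatorMatrix.IsIdempotentIntegral k L)
    {n : ℕ} [NeZero n] (V : Fin n → Type*) [∀ i, AddCommGroup (V i)] [∀ i, Module k (V i)]
    [∀ i, Module H (V i)] [∀ i, IsScalarTower k H (V i)]
    (hV : CommutatorMatrix.IsCompleteSimpleFamily H V)
    (hV0 : ∀ (h : H) (v : V 0), h • v = Coalgebra.counit (R := k) h • v)
    (E : Fin n → H) (hE : ∀ i, CommutatorMatrix.IsCentralPrimitiveIdempotent (E i))
    (hEV : ∀ (i : Fin n) (v : V i), E i • v = v)
    (m : ℕ) (hm : 1 ≤ m) :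
    CommutatorMatrix.iteratedCommutator k L m
        = ∑ i, ((CommutatorMatrix.commutatorMatrix k L V ^ m) i 0
            / (Module.finrank k (V i) : k) ^ 2) • E i ∧
    CommutatorMatrix.iteratedCommutator k L m
        = ∑ i, ((∑ j, (CommutatorMatrix.commutatorMatrix k L V ^ (m - 1)) i j)
            / (Module.finrank k (V i) : k) ^ 2) • E i ∧
    (∀ c : Fin n → k, CommutatorMatrix.iteratedCommutator k L m = ∑ i, c i • E i →
      ∀ i, ∃ q : ℚ, q ≠ 0 ∧ c i = (q : k)) ∧
    IsUnit (CommutatorMatrix.iteratedCommutator k L m) := by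
  obtain ⟨m, rfl⟩ : ∃ l, m = l + 1 := ⟨m - 1, by omega⟩
  have hsim := hV.simple
  have hfin := hL.finite_simple hV
  have hnt : ∀ i, Nontrivial (V i) := fun i => IsSimpleModule.nontrivial H (V i)
  have hd : ∀ i, Module.finrank k (V i) ≠ 0 := fun i => Module.finrank_pos.ne'
  have hact : ∀ (c : Fin n → k) (j : Fin n) (v : V j), (∑ i, c i • E i) • v = c j • v := by
    intro c j v
    have hE' : ∀ i, E i • v = (if i = j then (1 : k) else 0) • v := by
      intro i
      rw [hL.centralIdempotent_eq hV (hE i) (hEV i), hL.rightHit_character_smul hV]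
    rw [Finset.sum_smul]
    simp [smul_assoc, hE']
  have heq := hL.iteratedCommutator_eq hV hV0 hE hEV (m + 1)
  have hcoef : ∀ c : Fin n → k, CommutatorMatrix.iteratedCommutator k L (m + 1) =
      ∑ i, c i • E i → ∀ i, ∃ q : ℚ, q ≠ 0 ∧ c i = (q : k) := by
    intro c hc i
    obtain ⟨q, hq, hqe⟩ := hL.exists_pos_rat_commutatorMatrix_pow hV hV0 m i
    refine ⟨q / Module.finrank k (V i) ^ 2,
      div_ne_zero hq.ne' (pow_ne_zero _ (Nat.cast_ne_zero.2 (hd i))), ?_⟩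
    obtain ⟨v, hv⟩ := exists_ne (0 : V i)
    have h1 := hact c i v
    -- The coefficient of E i is read off from the action on a nonzero vector of V i, so an
    -- arbitrary c must agree with the formula.
    rw [← hc, heq, hact] at h1
    rw [← smul_left_injective k hv h1, hqe]
    push_cast
    rfl
  refine ⟨heq, ?_, hcoef, ?_⟩
  · rw [heq, Nat.add_sub_cancel]
    refine Finset.sum_congr rfl fun i _ => ?_
    -- Splitting off the last factor leaves its column 0, all ones, and so a row sum of the lower
    -- power.
    rw [pow_succ, Matrix.mul_apply]
    simp only [hL.commutatorMatrix_zero hV hV0, mul_one]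
  · obtain ⟨c, hc⟩ : ∃ c : Fin n → k, CommutatorMatrix.iteratedCommutator k L (m + 1) =
      ∑ i, c i • E i := ⟨_, heq⟩
    have hc0 : ∀ i, c i ≠ 0 := by
      intro i
      obtain ⟨q, hq, hqe⟩ := hcoef c hc i
      rw [hqe]
      exact_mod_cast hq
    rw [hc]
    refine ⟨⟨∑ i, c i • E i, ∑ i, (c i)⁻¹ • E i, hV.ext fun j v => ?_, hV.ext fun j v => ?_⟩, rfl⟩
    · rw [mul_smul, hact, hact, smul_smul, mul_inv_cancel₀ (hc0 j), one_smul, one_smul]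
    · rw [mul_smul, hact, hact, smul_smul, inv_mul_cancel₀ (hc0 j), one_smul, one_smul]
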